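/- Let $n\ge 2$ and $m\ge 1$, let $S=\mathbb C[x_0,\dots,x_n]$, and let $F_1,\dots,F_m\in S$ be irreducible homogeneous polynomials of degrees $d_1,\dots,d_m$ such that every hypersurface $X_i=\{F_i=0\}\subset\mathbb P^n=\mathbb P^n(\mathbb C)$ is smooth and $X_1\cup\dots\cup X_m$ is a normal crossings divisor, i.e. at every point of $\mathbb P^n$ the differentials $dF_i$ of those $F_i$ that vanish there are linearly independent. Put $d=\sum_i d_i$, $\hat F_i=\prod_{j\neq i}F_j$, $\hat d_i=\sum_{j\ne i}d_j=\deg\hat F_i$, and $X^{(2)}=\bigcup_{i<j}X_i\cap X_j$. Let $\mathcal J^{(2)}\subset\mathcal O_{\mathbb P^n}$ be the ideal sheaf of regular functions vanishing on $X^{(2)}$ and $J^{(2)}=\bigoplus_{k}H^0(\mathbb P^n,\mathcal J^{(2)}(k))\subset S$ the corresponding saturated homogeneous ideal. Then: a) $J^{(2)}$ is generated by $\hat F_1,\dots,\hat F_m$. b) The relations among these generators, i.e. the $S$-module of all $(a_1,\dots,a_m)\in S^m$ with $\sum_i a_i\hat F_i=0$, are generated by $F_j e_j-F_i e_i$, $1\le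 i<j\le m$ (that is, by the relations $F_j\hat F_j-F_i\hat F_i=0$), and also by the subset $R_j=F_j e_j-F_1 e_1$, $2\le j\le m$, where $e_1,\dots,e_m$ is the canonical basis of $S^m$. c) There is a resolution of $\mathcal J^{(2)}$, i.e. a short exact sequence of sheaves of modules on $\mathbb P^n$, $$0\to\mathcal O(-d)^{m-1}\xrightarrow{\ \delta_0\ }\bigoplus_{1\le i\le m}\mathcal O(-\hat d_i)\xrightarrow{\ \delta_1\ }\mathcal J^{(2)}\to 0,$$ where, $\{e_i\}$ denoting the respective canonical bases, $\delta_0(e_j)=F_j e_j-F_1 e_1$ for $2\le j\le m$ and $\delta_1(e_i)=\hat F_i$ for $1\le i\le m$. -/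

import Mathlib

open CategoryTheory CategoryTheory.Limits AlgebraicGeometry TopologicalSpace Opposite

noncomputable section

namespace LogForms

section Sheaves

variable {A : Type} {σ : Type} [CommRing A] [SetLike σ A] [AddSubgroupClass σ A]
  (𝒜 : ℕ → σ) [GradedRing 𝒜]

/-- The ring of all fractions `a / s`, `s ∉ x` (of arbitrary degrees), at a point `x` of `Proj`. -/
abbrev Loc (x : ProjectiveSpectrum 𝒜) : Type :=
  Localization.AtPrime x.asHomogeneousIdeal.toIdeal

/-- The family of these rings over the space `Proj`. -/
abbrev Germs (x : ProjectiveSpectrum.top 𝒜) : Type := Loc 𝒜 x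

variable {𝒜}

/-- The fraction `a / s` at `x`, where `s ∉ x`. -/
abbrev frac (x : ProjectiveSpectrum 𝒜) (a s : A) (hs : s ∉ x.asHomogeneousIdeal) : Loc 𝒜 x :=
  Localization.mk a ⟨s, hs⟩

/-- A family of germs on `U` is a fraction of degree `k` if it is given by one fraction `a / s` with
`a`, `s` homogeneous, `deg a = deg s + k`, and `s` vanishing nowhere on `U`. -/
def IsFractionOfDegree (k : ℤ) {U : Opens (ProjectiveSpectrum.top 𝒜)}
    (f : ∀ x : U, Germs 𝒜 x.1) : Prop :=
  ∃ (i j : ℕ) (a s : A), a ∈ 𝒜 i ∧ s ∈ 𝒜 j ∧ (i : ℤ) = j + k ∧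
    ∃ hs : ∀ x : U, s ∉ x.1.asHomogeneousIdeal, ∀ x : U, f x = frac x.1 a s (hs x)

variable (𝒜)

/-- Sections of `𝒪(k)`: families of germs that are locally fractions of degree `k`. -/
def twistPredicate (k : ℤ) : TopCat.LocalPredicate (Germs 𝒜) :=
  TopCat.PrelocalPredicate.sheafify
    { pred := fun f => IsFractionOfDegree k f
      res := by
        rintro V U i f ⟨p, q, a, s, ha, hs, hd, h, w⟩
        exact ⟨p, q, a, s, ha, hs, hd, fun x => h (i x), fun x => w (i x)⟩ }

/-- Families of germs that vanish at every point of `Z`. -/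
def vanishingPredicate (Z : Set (ProjectiveSpectrum 𝒜)) : TopCat.LocalPredicate (Germs 𝒜) where
  pred {U} f := ∀ x : U, x.1 ∈ Z → f x ∈ IsLocalRing.maximalIdeal (Germs 𝒜 x.1)
  res i f h x hx := h (i x) hx
  locality {U} f h x hx := by
    obtain ⟨V, hV, i, h⟩ := h x
    exact h ⟨x.1, hV⟩ hx

/-- Sections of `𝒥(k)`, `𝒥` the ideal sheaf of `Z`: sections of `𝒪(k)` that vanish on `Z`. -/
def idealPredicate (Z : Set (ProjectiveSpectrum 𝒜)) (k : ℤ) : TopCat.LocalPredicate (Germs 𝒜) :=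
  (twistPredicate 𝒜 k).and (vanishingPredicate 𝒜 Z)

variable {𝒜}

/-- A local predicate on families of germs that is stable under the operations of modules over the
structure sheaf. -/
structure IsModulePredicate (P : TopCat.LocalPredicate (Germs 𝒜)) : Prop where
  zero (U : Opens (ProjectiveSpectrum.top 𝒜)) : P.pred (fun x : U => (0 : Germs 𝒜 x.1))
  add {U : Opens (ProjectiveSpectrum.top 𝒜)} (f g : ∀ x : U, Germs 𝒜 x.1) :
    P.pred f → P.pred g → P.pred (fun x => f x + g x)
  neg {U : Opens (ProjectiveSpectrum.top 𝒜)} (f : ∀ x : U, Germs 𝒜 x.1) :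
    P.pred f → P.pred (fun x => -f x)
  smul {U : Opens (ProjectiveSpectrum.top 𝒜)} (r : Γ(Proj 𝒜, U)) (f : ∀ x : U, Germs 𝒜 x.1) :
    P.pred f → P.pred (fun x => (r.1 x).val * f x)

theorem mul_notMem (x : ProjectiveSpectrum 𝒜) {s t : A} (hs : s ∉ x.asHomogeneousIdeal)
    (ht : t ∉ x.asHomogeneousIdeal) : s * t ∉ x.asHomogeneousIdeal :=
  x.asHomogeneousIdeal.toIdeal.primeCompl.mul_mem hs ht

theorem one_notMem (x : ProjectiveSpectrum 𝒜) : (1 : A) ∉ x.asHomogeneousIdeal :=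
  x.asHomogeneousIdeal.toIdeal.primeCompl.one_mem

theorem exists_homogeneous_notMem (x : ProjectiveSpectrum 𝒜) (k : ℤ) :
    ∃ (i j : ℕ) (s : A), s ∈ 𝒜 j ∧ s ∉ x.asHomogeneousIdeal ∧ (i : ℤ) = j + k := by
  obtain ⟨f, m, f_deg, hm, hx⟩ : ∃ (f : A) (m : ℕ) (_ : f ∈ 𝒜 m) (_ : 0 < m),
      f ∉ x.asHomogeneousIdeal := by
    classical
    by_contra! H
    refine x.not_irrelevant_le fun z hz ↦ ?_
    rw [← DirectSum.sum_support_decompose 𝒜 z]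
    exact x.1.toIdeal.sum_mem fun k hk ↦ H _ k (SetLike.coe_mem _) <| by_contra <| by aesop
  refine ⟨(((k.natAbs * m : ℕ) : ℤ) + k).toNat, k.natAbs * m, f ^ k.natAbs, ?_, ?_, ?_⟩
  · simpa using SetLike.pow_mem_graded k.natAbs f_deg
  · exact fun h => hx (x.isPrime.mem_of_pow_mem _ h)
  · have h : k.natAbs * 1 ≤ k.natAbs * m := Nat.mul_le_mul_left _ hm
    generalize k.natAbs * m = c at h ⊢
    omega

theorem isModulePredicate_twist (k : ℤ) : IsModulePredicate (twistPredicate 𝒜 k) where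
  zero U x := by
    obtain ⟨i, j, s, hs, hx, hij⟩ := exists_homogeneous_notMem x.1 k
    refine ⟨U ⊓ ProjectiveSpectrum.basicOpen 𝒜 s, ⟨x.2, hx⟩, Opens.infLELeft _ _, i, j, 0, s,
      zero_mem _, hs, hij, fun y => y.2.2, fun y => (Localization.mk_zero _).symm⟩
  add f g hf hg x := by
    obtain ⟨V, hV, i, p, q, a, s, ha, hs, hd, h, w⟩ := hf x
    obtain ⟨V', hV', i', p', q', a', s', ha', hs', hd', h', w'⟩ := hg x
    refine ⟨V ⊓ V', ⟨hV, hV'⟩, Opens.infLELeft _ _ ≫ i, q + p', q + q', s * a' + s' * a, s * s',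
      ?_, SetLike.mul_mem_graded hs hs', ?_, ?_, ?_⟩
    · refine add_mem (SetLike.mul_mem_graded hs ha') ?_
      have : q + p' = q' + p := by omega
      exact this ▸ SetLike.mul_mem_graded hs' ha
    · push_cast; omega
    · exact fun y => mul_notMem y.1 (h ⟨y.1, y.2.1⟩) (h' ⟨y.1, y.2.2⟩)
    · intro y
      have e := w ⟨y.1, y.2.1⟩
      have e' := w' ⟨y.1, y.2.2⟩
      refine (congrArg₂ (· + ·) e e').trans ?_
      exact Localization.add_mk _ _ _ _
  neg f hf x := by
    obtain ⟨V, hV, i, p, q, a, s, ha, hs, hd, h, w⟩ := hf x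
    refine ⟨V, hV, i, p, q, -a, s, neg_mem ha, hs, hd, h, fun y => ?_⟩
    exact (congrArg (-·) (w y)).trans (Localization.neg_mk _ _)
  smul r f hf x := by
    obtain ⟨V, hV, i, p, q, a, s, ha, hs, hd, h, w⟩ := hf x
    obtain ⟨V', hV', i', p', ⟨b, hb⟩, ⟨t, ht⟩, h', w'⟩ := r.2 x
    refine ⟨V' ⊓ V, ⟨hV', hV⟩, Opens.infLERight _ _ ≫ i, p' + p, p' + q, b * a, t * s,
      SetLike.mul_mem_graded hb ha, SetLike.mul_mem_graded ht hs, ?_, ?_, ?_⟩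
    · push_cast; omega
    · exact fun y => mul_notMem y.1 (h' ⟨y.1, y.2.1⟩) (h ⟨y.1, y.2.2⟩)
    · intro y
      have e := w ⟨y.1, y.2.2⟩
      have e' := congrArg HomogeneousLocalization.val (w' ⟨y.1, y.2.1⟩)
      refine (congrArg₂ (· * ·) e' e).trans ?_
      exact Localization.mk_mul _ _ _ _

theorem isModulePredicate_ideal (Z : Set (ProjectiveSpectrum 𝒜)) (k : ℤ) :
    IsModulePredicate (idealPredicate 𝒜 Z k) where
  zero U := ⟨(isModulePredicate_twist k).zero U, fun _ _ => Ideal.zero_mem _⟩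
  add f g hf hg := ⟨(isModulePredicate_twist k).add f g hf.1 hg.1,
    fun x hx => Ideal.add_mem _ (hf.2 x hx) (hg.2 x hx)⟩
  neg f hf := ⟨(isModulePredicate_twist k).neg f hf.1,
    fun x hx => neg_mem (hf.2 x hx)⟩
  smul r f hf := ⟨(isModulePredicate_twist k).smul r f hf.1,
    fun x hx => Ideal.mul_mem_left _ _ (hf.2 x hx)⟩

/-- The families of germs on `U` satisfying a module predicate form a group. -/
def sectionsAddSubgroup {P : TopCat.LocalPredicate (Germs 𝒜)} (hP : IsModulePredicate P)
    (U : Opens (ProjectiveSpectrum.top 𝒜)) : AddSubgroup (∀ x : U, Germs 𝒜 x.1) where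
  carrier := {f | P.pred f}
  zero_mem' := hP.zero U
  add_mem' hf hg := hP.add _ _ hf hg
  neg_mem' hf := hP.neg _ hf

/-- Sections of the structure sheaf act on families of germs pointwise. -/
instance sectionsModule {P : TopCat.LocalPredicate (Germs 𝒜)} (hP : IsModulePredicate P)
    (U : Opens (ProjectiveSpectrum.top 𝒜)) : Module Γ(Proj 𝒜, U) (sectionsAddSubgroup hP U) where
  smul r f := ⟨fun x => (r.1 x).val * f.1 x, hP.smul r f.1 f.2⟩
  one_smul f := Subtype.ext (funext fun x =>
    (congrArg (· * f.1 x) (HomogeneousLocalization.val_one)).trans (one_mul _))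
  mul_smul _ _ f := Subtype.ext (funext fun x =>
    (congrArg (· * f.1 x) (HomogeneousLocalization.val_mul _ _)).trans (mul_assoc _ _ _))
  smul_zero _ := Subtype.ext (funext fun _ => mul_zero _)
  smul_add _ _ _ := Subtype.ext (funext fun _ => mul_add _ _ _)
  add_smul _ _ f := Subtype.ext (funext fun x =>
    (congrArg (· * f.1 x) (HomogeneousLocalization.val_add _ _)).trans (add_mul _ _ _))
  zero_smul f := Subtype.ext (funext fun x =>
    (congrArg (· * f.1 x) (HomogeneousLocalization.val_zero)).trans (zero_mul _))

/-- The presheaf of abelian groups of the families of germs satisfying a module predicate. -/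
def presheafOfPredicate {P : TopCat.LocalPredicate (Germs 𝒜)} (hP : IsModulePredicate P) :
    TopCat.Presheaf Ab (Proj 𝒜) where
  obj U := AddCommGrpCat.of (sectionsAddSubgroup hP U.unop)
  map i := AddCommGrpCat.ofHom
    { toFun := fun f => ⟨fun x => f.1 (i.unop x), P.res i.unop f.1 f.2⟩
      map_zero' := rfl
      map_add' := fun _ _ => rfl }

theorem isSheaf_presheafOfPredicate {P : TopCat.LocalPredicate (Germs 𝒜)}
    (hP : IsModulePredicate P) : (presheafOfPredicate hP).IsSheaf :=
  (TopCat.Presheaf.isSheaf_iff_isSheaf_comp (forget Ab) _).mpr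
    (TopCat.subpresheafToTypes.isSheaf P)

instance presheafModule {P : TopCat.LocalPredicate (Germs 𝒜)} (hP : IsModulePredicate P)
    (U : (Opens (Proj 𝒜))ᵒᵖ) :
    Module ((Proj 𝒜).ringCatSheaf.obj.obj U) ((presheafOfPredicate hP).obj U) :=
  sectionsModule hP U.unop

theorem presheafOfPredicate_map_smul {P : TopCat.LocalPredicate (Germs 𝒜)}
    (hP : IsModulePredicate P) {U V : (Opens (Proj 𝒜))ᵒᵖ} (i : U ⟶ V)
    (r : (Proj 𝒜).ringCatSheaf.obj.obj U) (f : (presheafOfPredicate hP).obj U) :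
    (presheafOfPredicate hP).map i (r • f) =
      (Proj 𝒜).ringCatSheaf.obj.map i r • (presheafOfPredicate hP).map i f := by
  refine Subtype.ext (funext fun x => ?_)
  rfl

/-- The sheaf of modules on `Proj` whose sections are the families of germs satisfying a module
predicate. -/
def modulesOfPredicate {P : TopCat.LocalPredicate (Germs 𝒜)} (hP : IsModulePredicate P) :
    (Proj 𝒜).Modules where
  val := PresheafOfModules.ofPresheaf (presheafOfPredicate hP)
    (fun _ _ => presheafOfPredicate_map_smul hP)
  isSheaf := isSheaf_presheafOfPredicate hP

/-- Multiplication by an element `G` of the graded ring, on sheaves of families of germs. -/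
def mulPresheafHom {P Q : TopCat.LocalPredicate (Germs 𝒜)} (hP : IsModulePredicate P)
    (hQ : IsModulePredicate Q) (G : A)
    (hG : ∀ (U : Opens (ProjectiveSpectrum.top 𝒜)) (f : ∀ x : U, Germs 𝒜 x.1),
      P.pred f → Q.pred (fun x => algebraMap A (Germs 𝒜 x.1) G * f x)) :
    presheafOfPredicate hP ⟶ presheafOfPredicate hQ where
  app U := AddCommGrpCat.ofHom
    { toFun := fun (f : sectionsAddSubgroup hP U.unop) =>
        (⟨fun x => algebraMap A (Germs 𝒜 x.1) G * f.1 x, hG U.unop f.1 f.2⟩ :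
          sectionsAddSubgroup hQ U.unop)
      map_zero' := Subtype.ext (funext fun _ => mul_zero _)
      map_add' := fun _ _ => Subtype.ext (funext fun _ => mul_add _ _ _) }
  naturality _ _ _ := rfl

/-- Multiplication by an element `G` of the graded ring, as a morphism of sheaves of modules. -/
def mulHom {P Q : TopCat.LocalPredicate (Germs 𝒜)} (hP : IsModulePredicate P)
    (hQ : IsModulePredicate Q) (G : A)
    (hG : ∀ (U : Opens (ProjectiveSpectrum.top 𝒜)) (f : ∀ x : U, Germs 𝒜 x.1),
      P.pred f → Q.pred (fun x => algebraMap A (Germs 𝒜 x.1) G * f x)) :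
    modulesOfPredicate hP ⟶ modulesOfPredicate hQ where
  val := PresheafOfModules.homMk (mulPresheafHom hP hQ G hG)
    (fun _ _ _ => Subtype.ext (funext fun _ => mul_left_comm _ _ _))

variable (𝒜) in
/-- The twisting sheaf `𝒪(k)` on `Proj 𝒜`. -/
def twist (k : ℤ) : (Proj 𝒜).Modules := modulesOfPredicate (isModulePredicate_twist (𝒜 := 𝒜) k)

variable (𝒜) in
/-- The twisted ideal sheaf `𝒥(k)` of a subset `Z` of `Proj 𝒜`, as a sheaf of modules. -/
def twistedIdealSheaf (Z : Set (ProjectiveSpectrum 𝒜)) (k : ℤ) : (Proj 𝒜).Modules :=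
  modulesOfPredicate (isModulePredicate_ideal (𝒜 := 𝒜) Z k)

/-- The ideal sheaf `𝒥` of regular functions vanishing on `Z`, as a sheaf of modules. -/
def idealSheaf (Z : Set (ProjectiveSpectrum 𝒜)) : (Proj 𝒜).Modules := twistedIdealSheaf 𝒜 Z 0

theorem twistPredicate_mul {G : A} {e : ℕ} (hG : G ∈ 𝒜 e) {a b : ℤ} (h : a + e = b)
    (U : Opens (ProjectiveSpectrum.top 𝒜)) (f : ∀ x : U, Germs 𝒜 x.1)
    (hf : (twistPredicate 𝒜 a).pred f) :
    (twistPredicate 𝒜 b).pred (fun x => algebraMap A (Germs 𝒜 x.1) G * f x) := by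
  intro x
  obtain ⟨V, hV, i, p, q, c, s, hc, hs, hd, hx, w⟩ := hf x
  refine ⟨V, hV, i, e + p, q, G * c, s, SetLike.mul_mem_graded hG hc, hs, by push_cast; omega,
    hx, fun y => ?_⟩
  refine (congrArg (algebraMap A (Germs 𝒜 y.1) G * ·) (w y)).trans ?_
  refine (congrArg (· * _) (Localization.mk_one_eq_algebraMap G).symm).trans ?_
  refine (Localization.mk_mul _ _ _ _).trans ?_
  exact congrArg (Localization.mk _) (one_mul _)

theorem algebraMap_mem_maximalIdeal (x : ProjectiveSpectrum 𝒜) (G : A) :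
    algebraMap A (Loc 𝒜 x) G ∈ IsLocalRing.maximalIdeal (Loc 𝒜 x) ↔ G ∈ x.asHomogeneousIdeal :=
  IsLocalization.AtPrime.to_map_mem_maximal_iff _ x.asHomogeneousIdeal.toIdeal G

/-- Multiplication by `G`, homogeneous of degree `e`, as a morphism `𝒪(a) ⟶ 𝒪(a + e)`. -/
def twistMul {G : A} {e : ℕ} (hG : G ∈ 𝒜 e) {a b : ℤ} (h : a + e = b) :
    twist 𝒜 a ⟶ twist 𝒜 b :=
  mulHom _ _ G (twistPredicate_mul hG h)

/-- Multiplication by `G`, homogeneous of degree `e` and vanishing on `Z`, as a morphism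
`𝒪(-e) ⟶ 𝒥`. -/
def twistMulIdeal (Z : Set (ProjectiveSpectrum 𝒜)) {G : A} {e : ℕ} (hG : G ∈ 𝒜 e)
    (hZ : ∀ x ∈ Z, G ∈ x.asHomogeneousIdeal) : twist 𝒜 (-e) ⟶ idealSheaf Z :=
  mulHom _ _ G fun U f hf => ⟨twistPredicate_mul hG (neg_add_cancel _) U f hf, fun x hx =>
    Ideal.mul_mem_right _ _ ((algebraMap_mem_maximalIdeal x.1 G).mpr (hZ _ hx))⟩

/-- The global family of germs defined by an element of the graded ring. -/
def globalGerms (a : A) (x : (⊤ : Opens (ProjectiveSpectrum.top 𝒜))) : Germs 𝒜 x.1 :=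
  algebraMap A (Germs 𝒜 x.1) a

theorem globalGerms_mem_iff (Z : Set (ProjectiveSpectrum 𝒜)) {k : ℕ} {a : A} (ha : a ∈ 𝒜 k) :
    (idealPredicate 𝒜 Z k).pred (globalGerms (𝒜 := 𝒜) a) ↔
      ∀ x ∈ Z, a ∈ x.asHomogeneousIdeal := by
  constructor
  · exact fun h x hx => (algebraMap_mem_maximalIdeal x a).mp (h.2 ⟨x, trivial⟩ hx)
  · refine fun h => ⟨fun x => ⟨⊤, trivial, 𝟙 _, k, 0, a, 1, ha, SetLike.one_mem_graded 𝒜,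
      by simp, ?_, ?_⟩, fun x hx => (algebraMap_mem_maximalIdeal x.1 a).mpr (h x.1 hx)⟩
    · exact fun y => one_notMem y.1
    · exact fun y => (Localization.mk_one_eq_algebraMap a).symm

theorem forall_globalGerms_mem_iff (Z : Set (ProjectiveSpectrum 𝒜)) (f : A) :
    (∀ k : ℕ, (idealPredicate 𝒜 Z k).pred
        (globalGerms (𝒜 := 𝒜) (DirectSum.decompose 𝒜 f k : A))) ↔
      ∀ x ∈ Z, f ∈ x.asHomogeneousIdeal := by
  simp only [globalGerms_mem_iff Z (SetLike.coe_mem _)]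
  classical
  refine ⟨fun h x hx => ?_, fun h k x hx => x.asHomogeneousIdeal.isHomogeneous k (h x hx)⟩
  rw [← DirectSum.sum_support_decompose 𝒜 f]
  exact x.asHomogeneousIdeal.toIdeal.sum_mem fun k _ => h k x hx

variable (𝒜) in
/-- The saturated homogeneous ideal `⨁ₖ H⁰(Proj 𝒜, 𝒥(k))` of `Z`: the elements of the graded ring
whose homogeneous component of each degree `k` is a global section of `𝒥(k)` (there are none in
negative degrees). -/
def saturatedIdeal (Z : Set (ProjectiveSpectrum 𝒜)) : Ideal A where
  carrier := {f | ∀ k : ℕ, (idealPredicate 𝒜 Z k).pred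
    (globalGerms (𝒜 := 𝒜) (DirectSum.decompose 𝒜 f k : A))}
  zero_mem' := (forall_globalGerms_mem_iff Z 0).mpr fun _ _ => Ideal.zero_mem _
  add_mem' hf hg := (forall_globalGerms_mem_iff Z _).mpr fun x hx => Ideal.add_mem _
    ((forall_globalGerms_mem_iff Z _).mp hf x hx) ((forall_globalGerms_mem_iff Z _).mp hg x hx)
  smul_mem' g _ hf := (forall_globalGerms_mem_iff Z _).mpr fun x hx => Ideal.mul_mem_left _ g
    ((forall_globalGerms_mem_iff Z _).mp hf x hx)

variable (𝒜) in
/-- The stratum `X⁽ʳ⁾ = ⋃_{|B| = r} ⋂_{i ∈ B} Xᵢ` of the hypersurfaces `Xᵢ = {Fᵢ = 0}`. -/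
def stratum {m : ℕ} (F : Fin m → A) (r : ℕ) : Set (ProjectiveSpectrum 𝒜) :=
  ⋃ (B : Finset (Fin m)) (_ : B.card = r), ⋂ i ∈ B, ProjectiveSpectrum.zeroLocus 𝒜 {F i}

/-- `F̂ᵢ = ∏_{j ≠ i} Fⱼ`. -/
def hat {m : ℕ} (F : Fin m → A) (i : Fin m) : A := ∏ j ∈ Finset.univ.erase i, F j

/-- `d̂ᵢ = ∑_{j ≠ i} dⱼ`. -/
def hatDeg {m : ℕ} (d : Fin m → ℕ) (i : Fin m) : ℕ := ∑ j ∈ Finset.univ.erase i, d j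

theorem hat_mem {m : ℕ} {d : Fin m → ℕ} {F : Fin m → A} (hF : ∀ i, F i ∈ 𝒜 (d i)) (i : Fin m) :
    hat F i ∈ 𝒜 (hatDeg d i) :=
  SetLike.prod_mem_graded _ _ _ fun j _ => hF j

theorem neg_sum_add {m : ℕ} (d : Fin m → ℕ) (i : Fin m) :
    (-((∑ j, d j : ℕ) : ℤ)) + d i = -(hatDeg d i : ℤ) := by
  have := Finset.add_sum_erase Finset.univ d (Finset.mem_univ i)
  unfold hatDeg
  omega

theorem hat_vanishes {m : ℕ} (F : Fin m → A) (i : Fin m) :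
    ∀ x ∈ stratum 𝒜 F 2, hat F i ∈ x.asHomogeneousIdeal := by
  intro x hx
  simp only [stratum, Set.mem_iUnion, Set.mem_iInter, ProjectiveSpectrum.mem_zeroLocus,
    Set.singleton_subset_iff] at hx
  obtain ⟨B, hB, hx⟩ := hx
  obtain ⟨j, hj, hji⟩ := Finset.exists_mem_ne (by omega : 1 < B.card) i
  exact Ideal.mem_of_dvd _ (Finset.dvd_prod_of_mem F (Finset.mem_erase.mpr
    ⟨hji, Finset.mem_univ j⟩)) (hx j hj)

instance (X : Scheme) : HasFiniteBiproducts X.Modules := Abelian.hasFiniteBiproducts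

/-- `δ₀ : 𝒪(-d)^{m-1} ⟶ ⨁ᵢ 𝒪(-d̂ᵢ)`, `eⱼ ↦ Fⱼ eⱼ - F₀ e₀` for `j ≠ 0`. -/
def δ₀ {m : ℕ} [NeZero m] {d : Fin m → ℕ} {F : Fin m → A} (hF : ∀ i, F i ∈ 𝒜 (d i)) :
    (⨁ fun _ : {j : Fin m // j ≠ 0} => twist 𝒜 (-((∑ i, d i : ℕ) : ℤ))) ⟶
      ⨁ fun i : Fin m => twist 𝒜 (-(hatDeg d i : ℤ)) :=
  biproduct.desc fun j =>
    twistMul (hF j.1) (neg_sum_add d j.1) ≫ biproduct.ι (fun i => twist 𝒜 (-(hatDeg d i : ℤ))) j.1 -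
      twistMul (hF 0) (neg_sum_add d 0) ≫ biproduct.ι (fun i => twist 𝒜 (-(hatDeg d i : ℤ))) 0

/-- `δ₁ : ⨁ᵢ 𝒪(-d̂ᵢ) ⟶ 𝒥⁽²⁾`, `eᵢ ↦ F̂ᵢ`. -/
def δ₁ {m : ℕ} {d : Fin m → ℕ} {F : Fin m → A} (hF : ∀ i, F i ∈ 𝒜 (d i)) :
    (⨁ fun i : Fin m => twist 𝒜 (-(hatDeg d i : ℤ))) ⟶ idealSheaf (stratum 𝒜 F 2) :=
  biproduct.desc fun i => twistMulIdeal _ (hat_mem hF i) (hat_vanishes F i)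

/-- The module of relations `∑ aᵢ Gᵢ = 0` among elements `Gᵢ` of a ring. -/
def relations {m : ℕ} (G : Fin m → A) : Submodule A (Fin m → A) :=
  LinearMap.ker (Fintype.linearCombination A G)

end Sheaves

/-- The homogeneous coordinate ring `ℂ[x₀, …, xₙ]`. -/
abbrev S (n : ℕ) : Type := MvPolynomial (Fin (n + 1)) ℂ

/-- The grading of `S n` by degree; `Proj (grading n)` is the complex projective space `ℙⁿ`. -/
abbrev grading (n : ℕ) : ℕ → Submodule ℂ (S n) := MvPolynomial.homogeneousSubmodule (Fin (n + 1)) ℂ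

instance (n : ℕ) : GradedRing (grading n) := MvPolynomial.gradedAlgebra

/-- The gradient of a polynomial at a point. -/
def grad {n : ℕ} (F : S n) (v : Fin (n + 1) → ℂ) : Fin (n + 1) → ℂ :=
  fun k => MvPolynomial.eval v (MvPolynomial.pderiv k F)

/-- The hypersurface `F = 0` in `ℙⁿ` is smooth (Jacobian criterion in homogeneous coordinates). -/
def IsSmoothHypersurface {n : ℕ} (F : S n) : Prop :=
  ∀ v : Fin (n + 1) → ℂ, v ≠ 0 → MvPolynomial.eval v F = 0 → grad F v ≠ 0

/-- The hypersurfaces `Fᵢ = 0` in `ℙⁿ` have normal crossings: at every point, the differentials of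
the `Fᵢ` that vanish there are linearly independent. -/
def IsNormalCrossings {n m : ℕ} (F : Fin m → S n) : Prop :=
  ∀ v : Fin (n + 1) → ℂ, v ≠ 0 →
    LinearIndependent ℂ fun i : {i : Fin m // MvPolynomial.eval v (F i) = 0} => grad (F i.1) v

end LogForms

end

/-!
Near a point `v ≠ 0` of affine space the equations `Fᵢ` that vanish at `v` have independent
differentials, so any two of them, `Fᵢ` and `Fⱼ`, generate a prime ideal in the local ring of `v`,
and a third one does not lie in it. For this the local ring of `v` is regular, a quotient of a
regular local ring by an element of `𝔪 \ 𝔪²` is regular, and regular local rings are domains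
(`isDomain_of_isRegularLocalRing`, `isPrime_map_span_pair`).

These local facts hold globally because membership in `(Fᵢ, Fⱼ)` can be tested away from the origin
(`mem_span_pair_of_forall_point`): by the Nullstellensatz, powers of the variables multiply a
polynomial that lies locally in `(Fᵢ, Fⱼ)` into this ideal, and as there are at least three
variables, a Koszul argument (`mem_span_pair_of_mul_mem`) removes these powers. Hence `(Fᵢ, Fⱼ)`
contains every polynomial that vanishes on `Xᵢ ∩ Xⱼ`, and each `Fₖ` with `k ≠ i, j` is a
nonzerodivisor modulo it. An induction on the number of hypersurfaces
(`mem_span_prod_erase`) then shows that the intersection of the ideals `(Fᵢ, Fⱼ)`, which is the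
saturated ideal of the stratum, is generated by the `F̂ᵢ`.

The relations are a matter of divisibility: the `Fᵢ` are pairwise non-associated primes, so
`∑ aᵢ F̂ᵢ = 0` forces `aᵢ = cᵢ Fᵢ`, and then `∑ cᵢ = 0`. The same computation in the rings of fractions
at the points of `Proj` shows that the sequence of sheaves is left exact on sections over every open
set (`exists_δ₀_app_eq`); the quotients `cᵢ` are again locally homogeneous fractions
(`twistPredicate_of_mul`). The map `δ₁` is locally surjective since the numerator of a local section
of the ideal sheaf, multiplied by a form that does not vanish at the given point, lies in the
saturated ideal (`exists_δ₁_app_eq_map`).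
-/

namespace LogForms

/-! ### Regular local rings -/

section RegularLocalRing

open IsLocalRing

theorem exists_finset_card_add_one_span_insert {K V : Type*} [Field K] [AddCommGroup V] [Module K V]
    [FiniteDimensional K V] {v : V} (hv : v ≠ 0) :
    ∃ s : Finset V, s.card + 1 ≤ Module.finrank K V ∧
      Submodule.span K (insert v (s : Set V)) = ⊤ := by
  classical
  have hli : LinearIndepOn K id ({v} : Set V) := LinearIndepOn.singleton (v := id) hv
  have hb : LinearIndepOn K id (hli.extend (Set.subset_univ _)) := hli.linearIndepOn_extend _
  have hsp : Submodule.span K (hli.extend (Set.subset_univ _)) = ⊤ := by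
    have := hli.span_extend_eq_span (Set.subset_univ _)
    simpa using this
  have hmem : v ∈ hli.extend (Set.subset_univ _) := hli.subset_extend _ rfl
  have hfin : (hli.extend (Set.subset_univ _)).Finite := hb.linearIndependent.setFinite
  have hcard : hfin.toFinset.card = Module.finrank K V := by
    have := hfin.fintype
    rw [← finrank_top K V, ← hsp, finrank_span_set_eq_card hb.linearIndependent]
    exact congrArg Finset.card (by ext; simp)
  refine ⟨hfin.toFinset.erase v, ?_, ?_⟩
  · rw [Finset.card_erase_add_one (by simpa using hmem), hcard]
  · rw [← Finset.coe_insert, Finset.insert_erase (by simpa using hmem)]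
    simpa using hsp

/-- An element of `𝔪 \ 𝔪²` belongs to a minimal system of generators of `𝔪`, by Nakayama's lemma. -/
theorem exists_finset_maximalIdeal_eq_span_insert {R : Type*} [CommRing R] [IsLocalRing R]
    [IsNoetherianRing R] {x : R} (hx : x ∈ maximalIdeal R) (hx2 : x ∉ maximalIdeal R ^ 2) :
    ∃ s : Finset R, s.card + 1 ≤ (maximalIdeal R).spanFinrank ∧
      maximalIdeal R = Ideal.span (insert x (s : Set R)) := by
  classical
  have hne : (maximalIdeal R).toCotangent ⟨x, hx⟩ ≠ 0 := by
    rwa [Ne, Ideal.toCotangent_eq_zero]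
  obtain ⟨s, hs, hsp⟩ := exists_finset_card_add_one_span_insert (K := ResidueField R)
    (V := CotangentSpace R) hne
  choose g hg using (maximalIdeal R).toCotangent_surjective
  have key : Submodule.span R (insert ⟨x, hx⟩ (g '' (s : Set (CotangentSpace R)))) = ⊤ := by
    rw [← CotangentSpace.span_image_eq_top_iff, Set.image_insert_eq, Set.image_image]
    simpa [hg] using hsp
  refine ⟨s.image fun y => (g y : R), ?_, ?_⟩
  · rw [spanFinrank_maximalIdeal_eq_finrank_cotangentSpace]
    exact (Nat.add_le_add_right Finset.card_image_le 1).trans hs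
  · have := congrArg (Submodule.map (maximalIdeal R).subtype) key
    rw [Submodule.map_span, Submodule.map_top, Submodule.range_subtype, Set.image_insert_eq,
      Set.image_image] at this
    refine this.symm.trans ?_
    simp [Ideal.span]

/-- Dividing by an element of `𝔪 \ 𝔪²` lowers the number of generators of the maximal ideal. -/
theorem spanFinrank_maximalIdeal_quotient_add_one_le {R : Type*} [CommRing R] [IsLocalRing R]
    [IsNoetherianRing R] {x : R} [IsLocalRing (R ⧸ Ideal.span {x})] (hx : x ∈ maximalIdeal R)
    (hx2 : x ∉ maximalIdeal R ^ 2) :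
    (maximalIdeal (R ⧸ Ideal.span {x})).spanFinrank + 1 ≤ (maximalIdeal R).spanFinrank := by
  classical
  obtain ⟨s, hs, hsp⟩ := exists_finset_maximalIdeal_eq_span_insert hx hx2
  refine le_trans (Nat.add_le_add_right ?_ 1) hs
  have hmax : maximalIdeal (R ⧸ Ideal.span {x}) =
      Ideal.span ((s.image (Ideal.Quotient.mk (Ideal.span {x})) : Finset _) : Set _) := by
    have h1 : (maximalIdeal R).map (Ideal.Quotient.mk (Ideal.span {x})) =
        maximalIdeal (R ⧸ Ideal.span {x}) := by
      have hloc := IsLocalHom.of_surjective (Ideal.Quotient.mk (Ideal.span {x}))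
        Ideal.Quotient.mk_surjective
      have hcomap : (maximalIdeal _).comap (Ideal.Quotient.mk (Ideal.span {x})) = maximalIdeal R :=
        ((local_hom_TFAE (Ideal.Quotient.mk (Ideal.span {x}))).out 0 4).mp hloc
      rw [← hcomap]
      exact Ideal.map_comap_of_surjective _ Ideal.Quotient.mk_surjective _
    rw [← h1, hsp, Ideal.map_span, Set.image_insert_eq, Finset.coe_image,
      Ideal.Quotient.eq_zero_iff_mem.mpr (Ideal.mem_span_singleton_self x), Ideal.span_insert_zero]
  rw [hmax]
  refine (Submodule.spanFinrank_span_le_ncard_of_finite (Finset.finite_toSet _)).trans ?_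
  rw [Set.ncard_coe_finset]
  exact Finset.card_image_le

theorem isLocalRing_quotient_span_singleton {R : Type*} [CommRing R] [IsLocalRing R] {x : R}
    (hx : x ∈ maximalIdeal R) : IsLocalRing (R ⧸ Ideal.span {x}) := by
  have : Nontrivial (R ⧸ Ideal.span {x}) := Ideal.Quotient.nontrivial_iff.mpr
    (ne_top_of_le_ne_top (maximalIdeal.isMaximal R).ne_top (by simpa [Ideal.span_le] using hx))
  exact .of_surjective' _ Ideal.Quotient.mk_surjective

theorem isRegularLocalRing_quotient_span_singleton {R : Type*} [CommRing R] [IsRegularLocalRing R]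
    {x : R} (hx : x ∈ maximalIdeal R) (hx2 : x ∉ maximalIdeal R ^ 2) :
    IsRegularLocalRing (R ⧸ Ideal.span {x}) := by
  have := isLocalRing_quotient_span_singleton hx
  apply IsRegularLocalRing.of_spanFinrank_maximalIdeal_le
  have h1 := spanFinrank_maximalIdeal_quotient_add_one_le hx hx2
  have h2 := ringKrullDim_le_ringKrullDim_quotient_add_card (R := R) (s := {x})
    (by simpa [IsLocalRing.ringJacobson_eq_maximalIdeal] using hx)
  have h3 := (isRegularLocalRing_iff R).mp inferInstance
  rw [← h3, Finset.coe_singleton, Finset.card_singleton, Nat.cast_one] at h2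
  have h4 : (((maximalIdeal (R ⧸ Ideal.span {x})).spanFinrank + 1 : ℕ) : WithBot ℕ∞) ≤
    ((maximalIdeal R).spanFinrank : WithBot ℕ∞) := by exact_mod_cast h1
  push_cast at h4
  exact ENat.WithBot.add_le_add_one_right_iff.mp (h4.trans h2)

/-- A regular local ring is a domain. Induction on the dimension: prime avoidance gives
`x ∈ 𝔪 \ 𝔪²` outside all minimal primes; `R / x` is regular, so `(x)` is prime, and a minimal
prime `Q ≤ (x)` satisfies `Q = x Q`, whence `Q = 0`. -/
theorem isDomain_of_isRegularLocalRing (R : Type*) [CommRing R] [IsRegularLocalRing R] :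
    IsDomain R := by
  induction h : (maximalIdeal R).spanFinrank using Nat.strong_induction_on generalizing R with
  | _ n ih =>
  by_cases h0 : maximalIdeal R = ⊥
  · exact (IsLocalRing.isField_iff_maximalIdeal_eq.mpr h0).isDomain
  have hfg : (maximalIdeal R).FG := (maximalIdeal R).fg_of_isNoetherianRing
  have hdim : ringKrullDim R ≠ 0 := by
    rw [← (isRegularLocalRing_iff R).mp inferInstance]
    exact_mod_cast fun h => h0 ((Submodule.spanFinrank_eq_zero_iff_eq_bot hfg).mp h)
  obtain ⟨x, hx, hx2, hxp⟩ : ∃ x ∈ maximalIdeal R, x ∉ maximalIdeal R ^ 2 ∧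
      ∀ p ∈ minimalPrimes R, x ∉ p := by
    by_contra! H
    have hfin := minimalPrimes.finite_of_isNoetherianRing R
    have := (Ideal.subset_union_prime' (s := hfin.toFinset) (f := id) (a := maximalIdeal R ^ 2)
      (b := maximalIdeal R ^ 2) (I := maximalIdeal R)
      (fun p hp => ((by simpa using hp : p ∈ minimalPrimes R)).isPrime)).mp (by
        intro x hx
        by_cases hx2 : x ∈ maximalIdeal R ^ 2
        · exact Or.inl (Or.inl hx2)
        · obtain ⟨p, hp, hxp⟩ := H x hx hx2
          exact Or.inr (Set.mem_biUnion (by simpa using hp) hxp))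
    -- By Nakayama's lemma, as the maximal ideal is not zero.
    have hsq : ¬ maximalIdeal R ≤ maximalIdeal R ^ 2 := fun hle => h0 <|
      Submodule.eq_bot_of_le_smul_of_le_jacobson_bot (maximalIdeal R) _ hfg
        (by rwa [pow_two] at hle) (IsLocalRing.jacobson_eq_maximalIdeal _ bot_ne_top).ge
    obtain h | h | ⟨p, hp, hle⟩ := this
    · exact hsq h
    · exact hsq h
    · have hp' : p ∈ minimalPrimes R := by simpa using hp
      have hpr := hp'.isPrime
      have hpm : p = maximalIdeal R := le_antisymm (le_maximalIdeal hpr.ne_top) hle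
      apply hdim
      rw [← maximalIdeal_height_eq_ringKrullDim, ← hpm, Ideal.height_eq_zero_iff.mpr hp']
      rfl
  have hreg := isRegularLocalRing_quotient_span_singleton hx hx2
  have hlt := spanFinrank_maximalIdeal_quotient_add_one_le hx hx2
  have hdom := ih _ (by omega) (R ⧸ Ideal.span {x}) rfl
  have hprime : (Ideal.span {x}).IsPrime := (Ideal.Quotient.isDomain_iff_prime _).mp hdom
  obtain ⟨Q, hQ, hQx⟩ := Ideal.exists_minimalPrimes_le (bot_le (a := Ideal.span {x}))
  have hQp : Q.IsPrime := hQ.isPrime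
  have hQ0 : Q = ⊥ := by
    refine Submodule.eq_bot_of_le_smul_of_le_jacobson_bot (maximalIdeal R) _
      Q.fg_of_isNoetherianRing (fun q hq => ?_)
      (IsLocalRing.jacobson_eq_maximalIdeal _ bot_ne_top).ge
    obtain ⟨a, rfl⟩ := Ideal.mem_span_singleton.mp (hQx hq)
    exact Submodule.smul_mem_smul hx ((hQp.mem_or_mem hq).resolve_left (hxp Q hQ))
  rw [hQ0] at hQp
  exact IsDomain.of_bot_isPrime R

/-- Two elements of the maximal ideal of a regular local ring that are independent modulo `𝔪²`
generate a prime ideal. -/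
theorem isPrime_span_pair_of_isRegularLocalRing {R : Type*} [CommRing R] [IsRegularLocalRing R]
    {x y : R} (hx : x ∈ maximalIdeal R) (hy : y ∈ maximalIdeal R) (hx2 : x ∉ maximalIdeal R ^ 2)
    (hy2 : y ∉ maximalIdeal R ^ 2 ⊔ Ideal.span {x}) : (Ideal.span {x, y}).IsPrime := by
  have hR := isRegularLocalRing_quotient_span_singleton hx hx2
  let π := Ideal.Quotient.mk (Ideal.span {x})
  have hloc : IsLocalHom π := IsLocalHom.of_surjective π Ideal.Quotient.mk_surjective
  have hcomap : (maximalIdeal (R ⧸ Ideal.span {x})).comap π = maximalIdeal R :=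
    ((local_hom_TFAE π).out 0 4).mp hloc
  have hmap : (maximalIdeal R).map π = maximalIdeal (R ⧸ Ideal.span {x}) := by
    rw [← hcomap]
    exact Ideal.map_comap_of_surjective _ Ideal.Quotient.mk_surjective _
  have h1 : π y ∈ maximalIdeal (R ⧸ Ideal.span {x}) := hmap ▸ Ideal.mem_map_of_mem π hy
  have h2 : π y ∉ maximalIdeal (R ⧸ Ideal.span {x}) ^ 2 := by
    intro h
    rw [← hmap, ← Ideal.map_pow, ← Ideal.mem_comap,
      Ideal.comap_map_of_surjective' π Ideal.Quotient.mk_surjective, Ideal.mk_ker] at h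
    exact hy2 h
  have h3 := isRegularLocalRing_quotient_span_singleton h1 h2
  have h4 := isDomain_of_isRegularLocalRing (_ ⧸ Ideal.span {π y})
  have h5 : (Ideal.span {π y}).IsPrime := (Ideal.Quotient.isDomain_iff_prime _).mp h4
  have h6 : (Ideal.span {π y}).comap π = Ideal.span {x, y} := by
    rw [← Set.image_singleton, ← Ideal.map_span,
      Ideal.comap_map_of_surjective' π Ideal.Quotient.mk_surjective, Ideal.mk_ker, sup_comm,
      ← Ideal.span_union, Set.singleton_union]
  exact h6 ▸ Ideal.comap_isPrime π _

end RegularLocalRing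

section PolynomialIdeals

open MvPolynomial IsLocalRing

/-! ### Differentials and the local ring of a point -/

section Gradient

variable {n : ℕ}

theorem grad_add (a b : S n) (v : Fin (n + 1) → ℂ) : grad (a + b) v = grad a v + grad b v := by
  ext k; simp [grad]

theorem grad_mul (a b : S n) (v : Fin (n + 1) → ℂ) :
    grad (a * b) v = eval v a • grad b v + eval v b • grad a v := by
  ext k; simp [grad, Derivation.leibniz]

theorem grad_zero (v : Fin (n + 1) → ℂ) : grad (0 : S n) v = 0 := by
  ext k; simp [grad]

/-- The ideal of polynomials vanishing at the point `v` of affine space. -/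
noncomputable def pointIdeal (v : Fin (n + 1) → ℂ) : Ideal (S n) := RingHom.ker (eval v)

theorem mem_pointIdeal {v : Fin (n + 1) → ℂ} {g : S n} : g ∈ pointIdeal v ↔ eval v g = 0 :=
  RingHom.mem_ker

instance (v : Fin (n + 1) → ℂ) : (pointIdeal v).IsPrime := RingHom.ker_isPrime (eval v)

theorem grad_eq_zero_of_mem_sq {v : Fin (n + 1) → ℂ} {h : S n} (hh : h ∈ pointIdeal v ^ 2) :
    grad h v = 0 := by
  rw [pow_two] at hh
  refine Submodule.mul_induction_on hh (fun a ha b hb => ?_) fun a b ha hb => ?_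
  · rw [grad_mul, mem_pointIdeal.mp ha, mem_pointIdeal.mp hb, zero_smul, zero_smul, add_zero]
  · rw [grad_add, ha, hb, add_zero]

theorem grad_mem_span_of_mem_sup {v : Fin (n + 1) → ℂ} {a b h : S n} (ha : eval v a = 0)
    (hb : eval v b = 0) (hh : h ∈ pointIdeal v ^ 2 ⊔ Ideal.span {a, b}) :
    grad h v ∈ Submodule.span ℂ {grad a v, grad b v} := by
  obtain ⟨p, hp, q, hq, rfl⟩ := Submodule.mem_sup.mp hh
  obtain ⟨c, d, rfl⟩ := Ideal.mem_span_pair.mp hq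
  simp only [grad_add, grad_mul, grad_eq_zero_of_mem_sq hp, ha, hb, zero_smul, add_zero, zero_add]
  exact Submodule.mem_span_pair.mpr ⟨_, _, rfl⟩

/-- Membership in `𝔪² + (a, b)` in the local ring of `v` is detected by differentials at `v`. -/
theorem grad_mem_span_of_algebraMap_mem_sup {v : Fin (n + 1) → ℂ} {a b h : S n}
    (ha : eval v a = 0) (hb : eval v b = 0) (hv : eval v h = 0)
    (hh : algebraMap (S n) (Localization.AtPrime (pointIdeal v)) h ∈
      (pointIdeal v ^ 2 ⊔ Ideal.span {a, b}).map
        (algebraMap (S n) (Localization.AtPrime (pointIdeal v)))) :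
    grad h v ∈ Submodule.span ℂ {grad a v, grad b v} := by
  obtain ⟨s, hs, hsh⟩ :=
    (IsLocalization.algebraMap_mem_map_algebraMap_iff (pointIdeal v).primeCompl _ _ _).mp hh
  have := grad_mem_span_of_mem_sup ha hb hsh
  rw [grad_mul, hv, zero_smul, add_zero] at this
  have hs' : eval v s ≠ 0 := fun h0 => hs (mem_pointIdeal.mpr h0)
  exact (Submodule.smul_mem_iff _ hs').mp this

/-- Two polynomials that vanish at `v` with independent differentials generate a prime ideal in the
local ring of `v`. -/
theorem isPrime_map_span_pair {v : Fin (n + 1) → ℂ} {a b : S n} (ha : eval v a = 0)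
    (hb : eval v b = 0) (ha' : grad a v ≠ 0) (hb' : grad b v ∉ Submodule.span ℂ {grad a v}) :
    ((Ideal.span {a, b}).map
      (algebraMap (S n) (Localization.AtPrime (pointIdeal v)))).IsPrime := by
  have hmem {g : S n} (hg : eval v g = 0) :
      algebraMap (S n) (Localization.AtPrime (pointIdeal v)) g ∈ maximalIdeal _ :=
    (IsLocalization.AtPrime.to_map_mem_maximal_iff _ (pointIdeal v) g).mpr (mem_pointIdeal.mpr hg)
  rw [Ideal.map_span, Set.image_pair]
  refine isPrime_span_pair_of_isRegularLocalRing (hmem ha) (hmem hb) (fun h => ha' ?_)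
    fun h => hb' ?_
  · rw [← Localization.AtPrime.map_eq_maximalIdeal, ← Ideal.map_pow] at h
    have := grad_mem_span_of_algebraMap_mem_sup (a := 0) (b := 0) (map_zero _) (map_zero _) ha
      (Ideal.map_mono le_sup_left h)
    simpa [grad_zero] using this
  · rw [← Localization.AtPrime.map_eq_maximalIdeal, ← Ideal.map_pow, ← Set.image_singleton,
      ← Ideal.map_span, ← Ideal.map_sup] at h
    have := grad_mem_span_of_algebraMap_mem_sup (a := a) (b := 0) ha (map_zero _) hb
      (Ideal.map_mono (sup_le_sup_left (Ideal.span_mono (by simp)) _) h)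
    simpa [grad_zero, Set.pair_comm _ (0 : Fin (n + 1) → ℂ)] using this

end Gradient

/-! ### From local to global membership -/

/-- An ideal generated by two coprime elements `g₁, g₂` has depth at least one along a regular
sequence `y₀, y₁, y₂`: Koszul relations between the multiples `yᵢ f` can be solved. -/
theorem mem_span_pair_of_mul_mem {R : Type*} [CommRing R] [IsDomain R] {g₁ g₂ y₀ y₁ y₂ f : R}
    (hg₁ : g₁ ≠ 0) (hg₂ : g₂ ≠ 0) (hg : ∀ c, g₁ ∣ g₂ * c → g₁ ∣ c) (hy₀ : y₀ ≠ 0)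
    (hy₁ : ∀ c, y₀ ∣ y₁ * c → y₀ ∣ c)
    (hy₂ : ∀ c, y₂ * c ∈ Ideal.span {y₀, y₁} → c ∈ Ideal.span {y₀, y₁})
    (h₀ : y₀ * f ∈ Ideal.span {g₁, g₂}) (h₁ : y₁ * f ∈ Ideal.span {g₁, g₂})
    (h₂ : y₂ * f ∈ Ideal.span {g₁, g₂}) : f ∈ Ideal.span {g₁, g₂} := by
  obtain ⟨a₀, b₀, e₀⟩ := Ideal.mem_span_pair.mp h₀
  obtain ⟨a₁, b₁, e₁⟩ := Ideal.mem_span_pair.mp h₁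
  obtain ⟨a₂, b₂, e₂⟩ := Ideal.mem_span_pair.mp h₂
  have syzygy {y z a b a' b' : R} (e : a * g₁ + b * g₂ = y * f) (e' : a' * g₁ + b' * g₂ = z * f) :
      ∃ c, z * a - y * a' = g₂ * c ∧ y * b' - z * b = g₁ * c := by
    have h : g₂ * (y * b' - z * b) = g₁ * (z * a - y * a') := by linear_combination y * e' - z * e
    obtain ⟨c, hc⟩ := hg _ ⟨_, h⟩
    refine ⟨c, mul_left_cancel₀ hg₁ ?_, hc⟩
    rw [← h, hc]; ring
  obtain ⟨c, hca, hcb⟩ := syzygy e₀ e₁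
  obtain ⟨c', hca', -⟩ := syzygy e₀ e₂
  obtain ⟨c'', hca'', -⟩ := syzygy e₁ e₂
  -- The cocycle relation puts `c` into the ideal `(y₀, y₁)`.
  have hc : y₂ * c = y₁ * c' - y₀ * c'' :=
    mul_left_cancel₀ hg₂ (by linear_combination -y₂ * hca + y₁ * hca' - y₀ * hca'')
  obtain ⟨u₁, u₀, hu⟩ := Ideal.mem_span_pair.mp
    (hy₂ c (Ideal.mem_span_pair.mpr ⟨-c'', c', by rw [hc]; ring⟩))
  obtain ⟨w, hw⟩ := hy₁ (a₀ - g₂ * u₀) ⟨a₁ + g₂ * u₁, by linear_combination hca - g₂ * hu⟩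
  obtain ⟨w', hw'⟩ := hy₁ (b₀ + g₁ * u₀) ⟨b₁ - g₁ * u₁, by linear_combination -hcb + g₁ * hu⟩
  refine Ideal.mem_span_pair.mpr ⟨w, w', mul_left_cancel₀ hy₀ ?_⟩
  linear_combination e₀ - g₁ * hw - g₂ * hw'

section Polynomials

variable {n : ℕ}

theorem mem_span_X_pow_pair_of_X_pow_mul_mem {i j k : Fin (n + 1)} (hik : i ≠ k) (hjk : j ≠ k)
    {a b c : ℕ} {f : S n}
    (h : X k ^ c * f ∈ Ideal.span {(X i ^ a : S n), X j ^ b}) :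
    f ∈ Ideal.span {(X i ^ a : S n), X j ^ b} := by
  have hspan : ({(X i ^ a : S n), X j ^ b} : Set (S n)) =
      (fun s => monomial s (1 : ℂ)) '' {Finsupp.single i a, Finsupp.single j b} := by
    simp [Set.image_pair, X_pow_eq_monomial]
  rw [hspan, mem_ideal_span_monomial_image] at h ⊢
  intro x hx
  have hx' : Finsupp.single k c + x ∈ (X k ^ c * f).support := by
    rw [mem_support_iff, X_pow_eq_monomial, coeff_monomial_mul, one_mul]
    exact mem_support_iff.mp hx
  obtain ⟨s, hs, hle⟩ := h _ hx'
  refine ⟨s, hs, fun l => ?_⟩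
  obtain rfl | rfl := hs
  · obtain rfl | hl := eq_or_ne l i
    · simpa [hik, Finsupp.single_apply, hik.symm] using hle l
    · simp [hl.symm]
  · obtain rfl | hl := eq_or_ne l j
    · simpa [Finsupp.single_apply, hjk.symm] using hle l
    · simp [hl.symm]

/-- The projective Nullstellensatz. -/
theorem exists_X_pow_mem {C : Ideal (S n)} (h : ∀ v : Fin (n + 1) → ℂ, v ≠ 0 → ∃ s ∈ C, eval v s ≠ 0)
    (k : Fin (n + 1)) : ∃ N, (X k : S n) ^ N ∈ C := by
  suffices (X k : S n) ∈ C.radical from this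
  rw [← vanishingIdeal_zeroLocus_eq_radical (K := ℂ) C]
  intro v hv
  by_contra hk
  obtain ⟨s, hs, hsv⟩ := h v (by rintro rfl; simp at hk)
  exact hsv (by simpa [aeval_eq_eval] using hv s hs)

/-- Membership in an ideal generated by two coprime polynomials in at least three variables can be
checked locally at the points other than the origin. -/
theorem mem_span_pair_of_forall_point (hn : 2 ≤ n) {g₁ g₂ f : S n} (hg₁ : g₁ ≠ 0) (hg₂ : g₂ ≠ 0)
    (hg : ∀ c, g₁ ∣ g₂ * c → g₁ ∣ c)
    (h : ∀ v : Fin (n + 1) → ℂ, v ≠ 0 → ∃ s, s * f ∈ Ideal.span {g₁, g₂} ∧ eval v s ≠ 0) :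
    f ∈ Ideal.span {g₁, g₂} := by
  have key (k : Fin (n + 1)) : ∃ N, (X k : S n) ^ N * f ∈ Ideal.span {g₁, g₂} := by
    refine exists_X_pow_mem (C := Submodule.comap (LinearMap.mulRight (S n) f)
      (Ideal.span {g₁, g₂})) (fun v hv => ?_) k
    obtain ⟨s, hs, hsv⟩ := h v hv
    exact ⟨s, hs, hsv⟩
  have h01 : (⟨0, by omega⟩ : Fin (n + 1)) ≠ ⟨1, by omega⟩ := by simp
  obtain ⟨a, ha⟩ := key ⟨0, by omega⟩
  obtain ⟨b, hb⟩ := key ⟨1, by omega⟩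
  obtain ⟨c, hc⟩ := key ⟨2, by omega⟩
  refine mem_span_pair_of_mul_mem hg₁ hg₂ hg (pow_ne_zero _ (X_ne_zero _)) (fun p hp => ?_)
    (fun p hp => mem_span_X_pow_pair_of_X_pow_mul_mem (by simp) (by simp) hp) ha hb hc
  refine (X_prime).pow_dvd_of_dvd_mul_left _ (fun hd => h01 ?_) hp
  exact (X_dvd_X).mp (X_prime.dvd_of_dvd_pow hd)

/-- An irreducible polynomial in several variables vanishes at a point other than the origin, as
otherwise it would divide powers of two different variables. -/
theorem exists_ne_zero_eval_eq_zero (hn : 2 ≤ n) {g : S n} (hg : Irreducible g) :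
    ∃ v : Fin (n + 1) → ℂ, v ≠ 0 ∧ eval v g = 0 := by
  by_contra! H
  have key (k : Fin (n + 1)) : g ∣ X k := by
    obtain ⟨N, hN⟩ := exists_X_pow_mem (C := Ideal.span {g})
      (fun v hv => ⟨g, Ideal.mem_span_singleton_self g, H v hv⟩) k
    exact hg.prime.dvd_of_dvd_pow (Ideal.mem_span_singleton.mp hN)
  have h01 : (⟨0, by omega⟩ : Fin (n + 1)) ≠ ⟨1, by omega⟩ := by simp
  have hassoc := hg.associated_of_dvd X_prime.irreducible (key ⟨0, by omega⟩)
  exact h01 (X_dvd_X.mp (hassoc.dvd_iff_dvd_left.mp (key ⟨1, by omega⟩)))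

end Polynomials

/-! ### Normal crossings -/

section NormalCrossings

variable {n m : ℕ} {F : Fin m → S n}

theorem IsNormalCrossings.grad_ne_zero (hnc : IsNormalCrossings F) {v : Fin (n + 1) → ℂ}
    (hv : v ≠ 0) {i : Fin m} (hi : eval v (F i) = 0) : grad (F i) v ≠ 0 :=
  LinearIndependent.ne_zero (⟨i, hi⟩ : {i : Fin m // eval v (F i) = 0}) (hnc v hv)

theorem IsNormalCrossings.grad_notMem_span_singleton (hnc : IsNormalCrossings F)
    {v : Fin (n + 1) → ℂ} (hv : v ≠ 0) {i j : Fin m} (hij : i ≠ j) (hi : eval v (F i) = 0)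
    (hj : eval v (F j) = 0) : grad (F j) v ∉ Submodule.span ℂ {grad (F i) v} := by
  have := (hnc v hv).notMem_span_image (s := {⟨i, hi⟩}) (x := ⟨j, hj⟩) (by simpa using hij.symm)
  simpa using this

theorem IsNormalCrossings.grad_notMem_span_pair (hnc : IsNormalCrossings F)
    {v : Fin (n + 1) → ℂ} (hv : v ≠ 0) {i j k : Fin m} (hik : i ≠ k) (hjk : j ≠ k)
    (hi : eval v (F i) = 0) (hj : eval v (F j) = 0) (hk : eval v (F k) = 0) :
    grad (F k) v ∉ Submodule.span ℂ {grad (F i) v, grad (F j) v} := by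
  have := (hnc v hv).notMem_span_image (s := {⟨i, hi⟩, ⟨j, hj⟩}) (x := ⟨k, hk⟩)
    (by simpa using ⟨hik.symm, hjk.symm⟩)
  simpa [Set.image_pair] using this

/-- Distinct components of a normal crossings divisor have coprime equations: at a zero of two
associated polynomials the differentials are proportional. -/
theorem IsNormalCrossings.not_dvd (hn : 2 ≤ n) (hirr : ∀ i, Irreducible (F i))
    (hnc : IsNormalCrossings F) {i j : Fin m} (hij : i ≠ j) : ¬ F i ∣ F j := by
  rintro ⟨u, hu⟩
  obtain ⟨v, hv, hi⟩ := exists_ne_zero_eval_eq_zero hn (hirr i)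
  refine hnc.grad_notMem_span_singleton hv hij hi (by rw [hu, map_mul, hi, zero_mul]) ?_
  rw [hu, grad_mul, hi, zero_smul, zero_add]
  exact Submodule.smul_mem _ _ (Submodule.mem_span_singleton_self _)

/-- Locality for the ideal of the intersection of two components: only points on both components
matter. -/
theorem IsNormalCrossings.mem_span_pair_of_forall_point (hn : 2 ≤ n)
    (hirr : ∀ i, Irreducible (F i)) (hnc : IsNormalCrossings F) {i j : Fin m} (hij : i ≠ j)
    {f : S n}
    (h : ∀ v : Fin (n + 1) → ℂ, v ≠ 0 → eval v (F i) = 0 → eval v (F j) = 0 →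
      algebraMap (S n) (Localization.AtPrime (pointIdeal v)) f ∈
        (Ideal.span {F i, F j}).map (algebraMap (S n) (Localization.AtPrime (pointIdeal v)))) :
    f ∈ Ideal.span {F i, F j} := by
  refine LogForms.mem_span_pair_of_forall_point hn (hirr i).ne_zero (hirr j).ne_zero
    (fun c hc => ((hirr i).prime.dvd_or_dvd hc).resolve_left (hnc.not_dvd hn hirr hij))
    fun v hv => ?_
  by_cases hi : eval v (F i) = 0
  · by_cases hj : eval v (F j) = 0
    · obtain ⟨s, hs, hsf⟩ := (IsLocalization.algebraMap_mem_map_algebraMap_iff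
        (pointIdeal v).primeCompl _ _ _).mp (h v hv hi hj)
      exact ⟨s, hsf, fun h0 => hs (mem_pointIdeal.mpr h0)⟩
    · exact ⟨F j, Ideal.mul_mem_right _ _ (Ideal.subset_span (by simp)), hj⟩
  · exact ⟨F i, Ideal.mul_mem_right _ _ (Ideal.subset_span (by simp)), hi⟩

/-- A third component of a normal crossings divisor is a nonzerodivisor modulo the equations of two
others. -/
theorem IsNormalCrossings.mem_span_pair_of_mul_mem (hn : 2 ≤ n) (hirr : ∀ i, Irreducible (F i))
    (hnc : IsNormalCrossings F) {i j k : Fin m} (hij : i ≠ j) (hik : i ≠ k) (hjk : j ≠ k)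
    {f : S n} (h : F k * f ∈ Ideal.span {F i, F j}) : f ∈ Ideal.span {F i, F j} := by
  refine hnc.mem_span_pair_of_forall_point hn hirr hij fun v hv hi hj => ?_
  have hprime := isPrime_map_span_pair hi hj (hnc.grad_ne_zero hv hi)
    (hnc.grad_notMem_span_singleton hv hij hi hj)
  have hmem := Ideal.mem_map_of_mem (algebraMap (S n) (Localization.AtPrime (pointIdeal v))) h
  rw [map_mul] at hmem
  refine (hprime.mem_or_mem hmem).resolve_left fun hk => ?_
  have hkv : eval v (F k) = 0 := by
    by_contra hkv
    refine hprime.ne_top (Ideal.eq_top_of_isUnit_mem _ hk ?_)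
    exact IsLocalization.map_units _
      (⟨F k, fun h => hkv (mem_pointIdeal.mp h)⟩ : (pointIdeal v).primeCompl)
  exact hnc.grad_notMem_span_pair hv hik hjk hi hj hkv
    (grad_mem_span_of_algebraMap_mem_sup hi hj hkv (Ideal.map_mono le_sup_right hk))

/-- The ideal `(Fᵢ, Fⱼ)` contains every polynomial that vanishes on `Xᵢ ∩ Xⱼ`. In the local ring of a
point on both components this ideal is prime; its contraction has a homogeneous core that is a point
of `Proj`, because it lies in the ideal of a point other than the origin. -/
theorem IsNormalCrossings.mem_span_pair_of_forall_zeroLocus (hn : 2 ≤ n)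
    (hirr : ∀ i, Irreducible (F i)) (hnc : IsNormalCrossings F) {d : Fin m → ℕ}
    (hF : ∀ i, F i ∈ grading n (d i)) {i j : Fin m} (hij : i ≠ j) {f : S n}
    (h : ∀ x : ProjectiveSpectrum (grading n), F i ∈ x.asHomogeneousIdeal →
      F j ∈ x.asHomogeneousIdeal → f ∈ x.asHomogeneousIdeal) : f ∈ Ideal.span {F i, F j} := by
  refine hnc.mem_span_pair_of_forall_point hn hirr hij fun v hv hi hj => ?_
  have hprime := isPrime_map_span_pair hi hj (hnc.grad_ne_zero hv hi)
    (hnc.grad_notMem_span_singleton hv hij hi hj)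
  let φ := algebraMap (S n) (Localization.AtPrime (pointIdeal v))
  let P := ((Ideal.span {F i, F j}).map φ).comap φ
  have hP : P.IsPrime := Ideal.comap_isPrime φ _
  have hPv : P ≤ pointIdeal v := by
    intro g hg
    by_contra hgv
    exact hprime.ne_top (Ideal.eq_top_of_isUnit_mem _ hg
      (IsLocalization.map_units _ (⟨g, hgv⟩ : (pointIdeal v).primeCompl)))
  have hmem (l : Fin m) (hl : F l ∈ Ideal.span {F i, F j}) : F l ∈ P.homogeneousCore (grading n) :=
    Ideal.mem_homogeneousCore_of_homogeneous_of_mem ⟨_, hF l⟩ (Ideal.mem_map_of_mem φ hl)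
  refine Ideal.toIdeal_homogeneousCore_le (grading n) P
    (h ⟨P.homogeneousCore (grading n), hP.homogeneousCore, fun hirrel => hv ?_⟩
      (hmem i (Ideal.subset_span (by simp))) (hmem j (Ideal.subset_span (by simp))))
  ext k
  have hX : (X k : S n) ∈ HomogeneousIdeal.irrelevant (grading n) := by
    rw [HomogeneousIdeal.mem_irrelevant_iff, GradedRing.proj_apply,
      DirectSum.decompose_of_mem_ne (grading n) (i := 1) (isHomogeneous_X ℂ k) one_ne_zero]
  simpa using mem_pointIdeal.mp (hPv (Ideal.toIdeal_homogeneousCore_le (grading n) P (hirrel hX)))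

end NormalCrossings

end PolynomialIdeals

/-! ### Intersections of the ideals of pairs -/

section IntersectionOfPairs

variable {R ι : Type*} [CommRing R] [DecidableEq ι] {F : ι → R}

theorem mem_span_pair_of_prod_mul_mem
    (hF : ∀ i j k, i ≠ j → i ≠ k → j ≠ k → ∀ f, F k * f ∈ Ideal.span {F i, F j} →
      f ∈ Ideal.span {F i, F j})
    {i j : ι} (hij : i ≠ j) (s : Finset ι) (hi : i ∉ s) (hj : j ∉ s) {f : R}
    (h : (∏ k ∈ s, F k) * f ∈ Ideal.span {F i, F j}) : f ∈ Ideal.span {F i, F j} := by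
  induction s using Finset.induction_on with
  | empty => simpa using h
  | insert k s hk ih =>
    rw [Finset.mem_insert, not_or] at hi hj
    rw [Finset.prod_insert hk, mul_assoc] at h
    exact ih hi.2 hj.2 (hF i j k hij hi.1 hj.1 _ h)

/-- The intersection of the ideals `(Fᵢ, Fₐ)`, `i ∈ s`, is generated by `∏ Fᵢ` and `Fₐ`. -/
theorem mem_span_prod_pair
    (hF : ∀ i j k, i ≠ j → i ≠ k → j ≠ k → ∀ f, F k * f ∈ Ideal.span {F i, F j} →
      f ∈ Ideal.span {F i, F j})
    {a : ι} (s : Finset ι) (ha : a ∉ s) {f : R} (h : ∀ i ∈ s, f ∈ Ideal.span {F i, F a}) :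
    f ∈ Ideal.span {∏ i ∈ s, F i, F a} := by
  induction s using Finset.induction_on with
  | empty =>
    rw [Finset.prod_empty, Ideal.span_insert, Ideal.span_singleton_one, top_sup_eq]
    trivial
  | insert b s hb ih =>
    rw [Finset.mem_insert, not_or] at ha
    obtain ⟨g, p, rfl⟩ := Ideal.mem_span_pair.mp
      (ih ha.2 fun i hi => h i (Finset.mem_insert_of_mem hi))
    have hg : g ∈ Ideal.span {F b, F a} := by
      refine mem_span_pair_of_prod_mul_mem hF (Ne.symm ha.1) s hb ha.2 ?_
      have hpa : p * F a ∈ Ideal.span {F b, F a} :=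
        Ideal.mul_mem_left _ _ (Ideal.subset_span (by simp))
      rw [mul_comm]
      exact (Ideal.add_mem_iff_left _ hpa).mp (h b (Finset.mem_insert_self b s))
    obtain ⟨u, w, rfl⟩ := Ideal.mem_span_pair.mp hg
    rw [Finset.prod_insert hb]
    exact Ideal.mem_span_pair.mpr ⟨u, w * (∏ i ∈ s, F i) + p, by ring⟩

/-- The intersection of the ideals `(Fᵢ, Fⱼ)` is generated by the products omitting one factor,
provided each `Fₖ` is a nonzerodivisor modulo `(Fᵢ, Fⱼ)`. -/
theorem mem_span_prod_erase
    (hF : ∀ i j k, i ≠ j → i ≠ k → j ≠ k → ∀ f, F k * f ∈ Ideal.span {F i, F j} →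
      f ∈ Ideal.span {F i, F j})
    {s : Finset ι} (hs : s.Nonempty) {f : R}
    (h : ∀ i ∈ s, ∀ j ∈ s, i ≠ j → f ∈ Ideal.span {F i, F j}) :
    f ∈ Ideal.span ((fun i => ∏ j ∈ s.erase i, F j) '' s) := by
  induction hs using Finset.Nonempty.cons_induction generalizing f with
  | singleton a => simp
  | cons a s ha hs ih =>
    rw [Finset.cons_eq_insert] at h ⊢
    have hne {i : ι} (hi : i ∈ s) : i ≠ a := fun e => ha (e ▸ hi)
    obtain ⟨g, p, rfl⟩ := Ideal.mem_span_pair.mp (mem_span_prod_pair hF s ha fun i hi =>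
      h i (Finset.mem_insert_of_mem hi) a (Finset.mem_insert_self a s) (hne hi))
    have hp : p ∈ Ideal.span ((fun i => ∏ j ∈ s.erase i, F j) '' s) := by
      refine ih fun i hi j hj hij => hF i j a hij (hne hi) (hne hj) _ ?_
      have hprod : g * ∏ i ∈ s, F i ∈ Ideal.span {F i, F j} := Ideal.mul_mem_left _ _ <|
        Ideal.mem_of_dvd _ (Finset.dvd_prod_of_mem F hi) (Ideal.subset_span (by simp))
      rw [mul_comm]
      exact (Ideal.add_mem_iff_right _ hprod).mp
        (h i (Finset.mem_insert_of_mem hi) j (Finset.mem_insert_of_mem hj) hij)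
    refine Ideal.add_mem _ (Ideal.mul_mem_left _ _ (Ideal.subset_span
      ⟨a, Finset.mem_insert_self a s, ?_⟩)) ?_
    · simp only [Finset.erase_insert ha]
    · have hle : Ideal.span ((fun i => ∏ j ∈ s.erase i, F j) '' s) ≤
          Submodule.comap (LinearMap.mulRight R (F a))
            (Ideal.span ((fun i => ∏ j ∈ (insert a s).erase i, F j) '' ↑(insert a s))) := by
        refine Ideal.span_le.mpr ?_
        rintro _ ⟨i, hi, rfl⟩
        refine Ideal.subset_span ⟨i, Finset.mem_insert_of_mem hi, ?_⟩
        simp only [LinearMap.mulRight_apply]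
        rw [Finset.erase_insert_of_ne (hne hi).symm,
          Finset.prod_insert (fun h => ha (Finset.mem_of_mem_erase h)), mul_comm]
      exact hle hp

end IntersectionOfPairs

/-! ### Relations among the products omitting one factor -/

section Relations

variable {R : Type} [CommRing R] {m : ℕ} {F : Fin m → R}

theorem mul_hat (F : Fin m → R) (i : Fin m) : F i * hat F i = ∏ j, F j :=
  Finset.mul_prod_erase _ _ (Finset.mem_univ i)

theorem dvd_hat {i j : Fin m} (hij : i ≠ j) : F i ∣ hat F j :=
  Finset.dvd_prod_of_mem F (Finset.mem_erase.mpr ⟨hij, Finset.mem_univ i⟩)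

theorem mem_relations {a : Fin m → R} : a ∈ relations (hat F) ↔ ∑ i, a i * hat F i = 0 := by
  rw [relations, LinearMap.mem_ker, Fintype.linearCombination_apply]
  rfl

/-- A relation among the `F̂ᵢ` has the form `aᵢ = cᵢ Fᵢ`: modulo `Fᵢ` all `F̂ⱼ` with `j ≠ i`
vanish, whereas `F̂ᵢ` is a product of elements prime to `Fᵢ`. -/
theorem exists_eq_mul_of_sum_mul_hat_eq_zero [IsDomain R] (hF : ∀ i, Prime (F i))
    (hdvd : ∀ i j, i ≠ j → ¬ F i ∣ F j) {a : Fin m → R} (ha : ∑ i, a i * hat F i = 0) :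
    ∃ c : Fin m → R, (∀ i, a i = F i * c i) ∧ ∑ i, c i = 0 := by
  have key (i : Fin m) : F i ∣ a i := by
    have h : F i ∣ a i * hat F i := by
      rw [← Finset.add_sum_erase _ _ (Finset.mem_univ i)] at ha
      rw [eq_neg_of_add_eq_zero_left ha, dvd_neg]
      exact Finset.dvd_sum fun j hj => (dvd_hat (Finset.ne_of_mem_erase hj).symm).mul_left _
    refine ((hF i).dvd_or_dvd h).resolve_right fun h => ?_
    obtain ⟨j, hj, hij⟩ := (hF i).exists_mem_finset_dvd h
    exact hdvd i j (Finset.ne_of_mem_erase hj).symm hij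
  choose c hc using key
  refine ⟨c, hc, ?_⟩
  have hprod : (∏ j, F j) ≠ 0 := Finset.prod_ne_zero_iff.mpr fun j _ => (hF j).ne_zero
  refine (mul_eq_zero.mp (?_ : (∏ j, F j) * ∑ i, c i = 0)).resolve_left hprod
  rw [← ha, Finset.mul_sum]
  exact Finset.sum_congr rfl fun i _ => by rw [← mul_hat F i, hc i]; ring

theorem single_sub_single_mem_relations (i j : Fin m) :
    (Pi.single j (F j) - Pi.single i (F i) : Fin m → R) ∈ relations (hat F) := by
  rw [mem_relations]
  simp [sub_mul, Pi.single_apply, Finset.sum_sub_distrib, mul_hat]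

theorem relations_le_span_single_sub_single_zero [NeZero m] [IsDomain R] (hF : ∀ i, Prime (F i))
    (hdvd : ∀ i j, i ≠ j → ¬ F i ∣ F j) :
    relations (hat F) ≤ Submodule.span R
      {v | ∃ j : Fin m, j ≠ 0 ∧ v = Pi.single j (F j) - Pi.single 0 (F 0)} := by
  intro a ha
  obtain ⟨c, hc, hc0⟩ := exists_eq_mul_of_sum_mul_hat_eq_zero hF hdvd (mem_relations.mp ha)
  have : a = ∑ j, c j • (Pi.single j (F j) - Pi.single 0 (F 0) : Fin m → R) := by
    simp only [smul_sub, Finset.sum_sub_distrib, ← Finset.sum_smul, hc0, zero_smul, sub_zero]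
    ext i
    simp [hc, Pi.single_apply, mul_comm]
  rw [this]
  refine Submodule.sum_mem _ fun j _ => ?_
  obtain rfl | hj := eq_or_ne j 0
  · simp
  · exact Submodule.smul_mem _ _ (Submodule.subset_span ⟨j, hj, rfl⟩)

theorem relations_hat_eq_span_single_sub_single_zero [NeZero m] [IsDomain R]
    (hF : ∀ i, Prime (F i)) (hdvd : ∀ i j, i ≠ j → ¬ F i ∣ F j) :
    relations (hat F) = Submodule.span R
      {v | ∃ j : Fin m, j ≠ 0 ∧ v = Pi.single j (F j) - Pi.single 0 (F 0)} := by
  refine le_antisymm (relations_le_span_single_sub_single_zero hF hdvd) (Submodule.span_le.mpr ?_)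
  rintro _ ⟨j, -, rfl⟩
  exact single_sub_single_mem_relations 0 j

theorem relations_hat_eq_span_single_sub_single [NeZero m] [IsDomain R]
    (hF : ∀ i, Prime (F i)) (hdvd : ∀ i j, i ≠ j → ¬ F i ∣ F j) :
    relations (hat F) = Submodule.span R
      {v | ∃ i j : Fin m, i < j ∧ v = Pi.single j (F j) - Pi.single i (F i)} := by
  refine le_antisymm ((relations_le_span_single_sub_single_zero hF hdvd).trans
    (Submodule.span_mono ?_)) (Submodule.span_le.mpr ?_)
  · rintro _ ⟨j, hj, rfl⟩
    exact ⟨0, j, Fin.pos_iff_ne_zero.mpr hj, rfl⟩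
  · rintro _ ⟨i, j, -, rfl⟩
    exact single_sub_single_mem_relations i j

end Relations

/-! ### The saturated ideal of the stratum -/

section SaturatedIdeal

variable {n m : ℕ} {F : Fin m → S n}

theorem mem_stratum_two_iff {x : ProjectiveSpectrum (grading n)} :
    x ∈ stratum (grading n) F 2 ↔
      ∃ i j, i ≠ j ∧ F i ∈ x.asHomogeneousIdeal ∧ F j ∈ x.asHomogeneousIdeal := by
  simp only [stratum, Set.mem_iUnion, Set.mem_iInter, ProjectiveSpectrum.mem_zeroLocus,
    Set.singleton_subset_iff, Finset.card_eq_two]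
  constructor
  · rintro ⟨_, ⟨i, j, hij, rfl⟩, h⟩
    exact ⟨i, j, hij, h i (by simp), h j (by simp)⟩
  · rintro ⟨i, j, hij, hi, hj⟩
    refine ⟨{i, j}, ⟨i, j, hij, rfl⟩, fun k hk => ?_⟩
    obtain rfl | rfl : k = i ∨ k = j := by simpa using hk
    exacts [hi, hj]

theorem IsNormalCrossings.saturatedIdeal_eq_span_hat [NeZero m] (hn : 2 ≤ n)
    (hirr : ∀ i, Irreducible (F i)) (hnc : IsNormalCrossings F) {d : Fin m → ℕ}
    (hF : ∀ i, F i ∈ grading n (d i)) :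
    saturatedIdeal (grading n) (stratum (grading n) F 2) = Ideal.span (Set.range (hat F)) := by
  refine le_antisymm (fun f hf => ?_) (Ideal.span_le.mpr ?_)
  · have hf' := (forall_globalGerms_mem_iff _ f).mp hf
    have := mem_span_prod_erase (F := F) (s := Finset.univ)
      (fun i j k hij hik hjk f => hnc.mem_span_pair_of_mul_mem hn hirr hij hik hjk)
      Finset.univ_nonempty (f := f) fun i _ j _ hij =>
        hnc.mem_span_pair_of_forall_zeroLocus hn hirr hF hij fun x hi hj =>
          hf' x (mem_stratum_two_iff.mpr ⟨i, j, hij, hi, hj⟩)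
    rw [Finset.coe_univ, Set.image_univ] at this
    exact this
  · rintro _ ⟨i, rfl⟩
    exact (forall_globalGerms_mem_iff _ _).mpr (hat_vanishes F i)

end SaturatedIdeal

noncomputable section

/-! ### Sections of sheaves of modules -/

section SheavesOfModules

variable {X : Scheme}

theorem modules_sum_app {M N : X.Modules} {ι : Type*} (s : Finset ι) (f : ι → (M ⟶ N))
    (U : X.Opens) (z : Γ(M, U)) : (∑ i ∈ s, f i).app U z = ∑ i ∈ s, (f i).app U z := by
  classical
  induction s using Finset.induction_on with
  | empty => simp
  | insert i s hi ih => rw [Finset.sum_insert hi, Finset.sum_insert hi, ← ih]; rfl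

theorem modules_app_injective_of_mono {M N : X.Modules} (f : M ⟶ N) [Mono f] (U : X.Opens) :
    Function.Injective (f.app U) := by
  have h : Mono ((Scheme.Modules.toPresheaf X).map f) := inferInstance
  have h' : Mono (f.app U) := (NatTrans.mono_iff_mono_app _).mp h (op U)
  exact (AddCommGrpCat.mono_iff_injective _).mp h'

/-- A complex of sheaves of modules whose complexes of sections are left exact is left exact. -/
theorem modules_exact_and_mono_of_sections (S : ShortComplex X.Modules)
    (hinj : ∀ U (y : Γ(S.X₁, U)), S.f.app U y = 0 → y = 0)
    (hex : ∀ U (x : Γ(S.X₂, U)), S.g.app U x = 0 → ∃ y, S.f.app U y = x) :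
    S.Exact ∧ Mono S.f := by
  -- The comparison with the kernel of `g` is bijective on sections.
  let κ := kernel.lift S.g S.f S.zero
  have hκ : κ ≫ kernel.ι S.g = S.f := kernel.lift_ι _ _ _
  have hκ' (U : X.Opens) (y : Γ(S.X₁, U)) : (kernel.ι S.g).app U (κ.app U y) = S.f.app U y :=
    congrArg (fun (φ : S.X₁ ⟶ S.X₂) => φ.app U y) hκ
  have hι (U : X.Opens) (x : Γ(kernel S.g, U)) : S.g.app U ((kernel.ι S.g).app U x) = 0 :=
    congrArg (fun (φ : kernel S.g ⟶ S.X₃) => φ.app U x) (kernel.condition S.g)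
  have hiso : IsIso κ := by
    refine Scheme.Modules.Hom.isIso_iff_isIso_app.mpr fun U => ?_
    refine (ConcreteCategory.isIso_iff_bijective _).mpr ⟨?_, fun x => ?_⟩
    · refine (injective_iff_map_eq_zero (κ.app U).hom).mpr fun y hy => hinj U y ?_
      rw [← hκ' U y]
      exact (congrArg _ hy).trans (map_zero _)
    · obtain ⟨y, hy⟩ := hex U _ (hι U x)
      exact ⟨y, modules_app_injective_of_mono (kernel.ι S.g) U ((hκ' U y).trans hy)⟩
  exact ⟨S.exact_iff_epi_kernel_lift.mpr (inferInstanceAs (Epi κ)), hκ ▸ mono_comp _ _⟩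

/-- A locally surjective morphism of sheaves of modules is an epimorphism. -/
theorem modules_epi_of_locally_surjective {M N : X.Modules} (g : M ⟶ N)
    (h : ∀ (U : X.Opens) (s : Γ(N, U)), ∀ x ∈ U, ∃ (V : X.Opens) (i : V ⟶ U) (t : Γ(M, V)),
      x ∈ V ∧ g.app V t = N.presheaf.map i.op s) : Epi g := by
  refine Preadditive.epi_of_cancel_zero g fun {B} φ hφ => ?_
  ext U s
  choose V i t hV ht using fun x : U => h U s x.1 x.2
  refine TopCat.Sheaf.eq_of_locally_eq' ⟨B.presheaf, B.isSheaf⟩ V U i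
    (fun x hx => Opens.mem_iSup.mpr ⟨⟨x, hx⟩, hV ⟨x, hx⟩⟩) _ _ fun x => ?_
  have h1 : B.presheaf.map (i x).op (φ.app U s) = φ.app (V x) (N.presheaf.map (i x).op s) :=
    (ConcreteCategory.congr_hom (φ.mapPresheaf.naturality (i x).op) s).symm
  have h2 : φ.app (V x) (g.app (V x) (t x)) = 0 :=
    congrArg (fun (ψ : M ⟶ B) => ψ.app (V x) (t x)) hφ
  refine (h1.trans ?_).trans (map_zero _).symm
  rw [← ht x, h2]

variable {ι : Type} [Fintype ι] (M : ι → X.Modules)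

theorem biproduct_section_ext (U : X.Opens) {y z : Γ(⨁ M, U)}
    (h : ∀ i, (biproduct.π M i).app U y = (biproduct.π M i).app U z) : y = z := by
  have key (z : Γ(⨁ M, U)) :
      z = ∑ i, (biproduct.ι M i).app U ((biproduct.π M i).app U z) := by
    have := congrArg (fun (φ : ⨁ M ⟶ ⨁ M) => φ.app U z) (biproduct.total (f := M))
    exact this.symm.trans (modules_sum_app _ _ U z)
  rw [key y, key z]
  exact Finset.sum_congr rfl fun i _ => by rw [h i]

theorem exists_biproduct_section (U : X.Opens) (t : ∀ i, Γ(M i, U)) :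
    ∃ z : Γ(⨁ M, U), ∀ i, (biproduct.π M i).app U z = t i := by
  classical
  let u : ∀ i, Γ(⨁ M, U) := fun i => (biproduct.ι M i).app U (t i)
  refine ⟨∑ i, u i, fun i => ?_⟩
  refine (map_sum ((biproduct.π M i).app U).hom u Finset.univ).trans ?_
  refine (Finset.sum_eq_single i (fun j _ hj => ?_) (by simp)).trans ?_
  · exact congrArg (fun (φ : M j ⟶ M i) => φ.app U (t j)) (biproduct.ι_π_ne M hj)
  · exact congrArg (fun (φ : M i ⟶ M i) => φ.app U (t i)) (biproduct.ι_π_self M i)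

theorem biproduct_desc_app {N : X.Modules} (f : ∀ i, M i ⟶ N) (U : X.Opens) (z : Γ(⨁ M, U)) :
    (biproduct.desc f).app U z = ∑ i, (f i).app U ((biproduct.π M i).app U z) := by
  rw [biproduct.desc_eq]
  exact modules_sum_app _ _ U z

end SheavesOfModules

/-! ### Sections as families of germs -/

section Germs

variable {A σ : Type} [CommRing A] [SetLike σ A] [AddSubgroupClass σ A] {𝒜 : ℕ → σ}
  [GradedRing 𝒜]

/-- The family of germs that underlies a section of a sheaf given by a module predicate. -/
def germs {P : TopCat.LocalPredicate (Germs 𝒜)} {hP : IsModulePredicate P} {U : (Proj 𝒜).Opens}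
    (s : Γ(modulesOfPredicate hP, U)) : ∀ x : U, Germs 𝒜 x.1 :=
  (show sectionsAddSubgroup hP U from s).1

/-- The section given by a family of germs that satisfies a module predicate. -/
def sectionOfGerms {P : TopCat.LocalPredicate (Germs 𝒜)} (hP : IsModulePredicate P)
    {U : (Proj 𝒜).Opens} (f : ∀ x : U, Germs 𝒜 x.1) (hf : P.pred f) :
    Γ(modulesOfPredicate hP, U) :=
  show sectionsAddSubgroup hP U from ⟨f, hf⟩

variable {P : TopCat.LocalPredicate (Germs 𝒜)} {hP : IsModulePredicate P} {U : (Proj 𝒜).Opens}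

theorem pred_germs (s : Γ(modulesOfPredicate hP, U)) : P.pred (germs s) :=
  (show sectionsAddSubgroup hP U from s).2

theorem germs_injective : Function.Injective (germs (hP := hP) (U := U)) :=
  fun _ _ h => Subtype.ext h

theorem germs_sum {ι : Type*} (t : Finset ι) (s : ι → Γ(modulesOfPredicate hP, U)) :
    germs (∑ i ∈ t, s i) = ∑ i ∈ t, germs (s i) := by
  classical
  induction t using Finset.induction_on with
  | empty => rfl
  | insert i t hi ih => rw [Finset.sum_insert hi, Finset.sum_insert hi, ← ih]; rfl

end Germs

/-! ### Fractions at the points of Proj -/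

section Fractions

variable {A σ : Type} [CommRing A] [SetLike σ A] [AddSubgroupClass σ A] {𝒜 : ℕ → σ}
  [GradedRing 𝒜]

theorem eq_frac_iff {x : ProjectiveSpectrum 𝒜} {z : Loc 𝒜 x} {a s : A}
    (hs : s ∉ x.asHomogeneousIdeal) :
    z = frac x a s hs ↔ algebraMap A (Loc 𝒜 x) s * z = algebraMap A (Loc 𝒜 x) a := by
  rw [frac, Localization.mk_eq_mk', IsLocalization.eq_mk'_iff_mul_eq, mul_comm]

theorem exists_decompose_notMem {x : ProjectiveSpectrum 𝒜} {h : A}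
    (hx : h ∉ x.asHomogeneousIdeal) :
    ∃ k, (DirectSum.decompose 𝒜 h k : A) ∉ x.asHomogeneousIdeal := by
  classical
  by_contra! H
  refine hx ?_
  rw [← DirectSum.sum_support_decompose 𝒜 h]
  exact x.asHomogeneousIdeal.toIdeal.sum_mem fun k _ => H k

/-- If a sum `∑ bᵢ gᵢ` with `gᵢ` homogeneous of degree `eᵢ` is homogeneous of degree `p`, its
coefficients can be replaced by homogeneous ones of degrees `p - eᵢ`, or by zero when `p < eᵢ`. -/
theorem exists_homogeneous_coeff {ι : Type*} [Fintype ι] {g : ι → A} {e : ι → ℕ}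
    (hg : ∀ i, g i ∈ 𝒜 (e i)) {p : ℕ} {c : A} {b : ι → A} (hc : c = ∑ i, b i * g i) :
    ∃ b' : ι → A, (DirectSum.decompose 𝒜 c p : A) = ∑ i, b' i * g i ∧
      ∀ i, b' i = 0 ∨ ∃ l, b' i ∈ 𝒜 l ∧ l + e i = p := by
  classical
  refine ⟨fun i => if e i ≤ p then (DirectSum.decompose 𝒜 (b i) (p - e i) : A) else 0, ?_,
    fun i => ?_⟩
  · rw [hc, DirectSum.decompose_sum, DFinsupp.finsetSum_apply, AddSubmonoidClass.coe_finsetSum]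
    refine Finset.sum_congr rfl fun i _ => ?_
    rw [DirectSum.coe_decompose_mul_of_right_mem 𝒜 p (hg i), ite_mul, zero_mul]
  · dsimp only
    split_ifs with h
    · exact Or.inr ⟨p - e i, SetLike.coe_mem _, by omega⟩
    · exact Or.inl rfl

variable [IsDomain A]

instance (x : ProjectiveSpectrum 𝒜) : IsDomain (Loc 𝒜 x) :=
  IsLocalization.isDomain_localization (Ideal.primeCompl_le_nonZeroDivisors _)

theorem algebraMap_loc_injective (x : ProjectiveSpectrum 𝒜) :
    Function.Injective (algebraMap A (Loc 𝒜 x)) :=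
  IsLocalization.injective _ (Ideal.primeCompl_le_nonZeroDivisors x.asHomogeneousIdeal.toIdeal)

theorem algebraMap_loc_ne_zero (x : ProjectiveSpectrum 𝒜) {a : A} (ha : a ≠ 0) :
    algebraMap A (Loc 𝒜 x) a ≠ 0 :=
  (map_ne_zero_iff _ (algebraMap_loc_injective x)).mpr ha

/-- The relations among the `F̂ᵢ` in the ring of fractions at a point. -/
theorem exists_loc_eq_mul_of_sum_hat_mul_eq_zero {m : ℕ} {F : Fin m → A} (hF : ∀ i, Prime (F i))
    (hdvd : ∀ i j, i ≠ j → ¬ F i ∣ F j) (x : ProjectiveSpectrum 𝒜) {z : Fin m → Loc 𝒜 x}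
    (hz : ∑ i, algebraMap A (Loc 𝒜 x) (hat F i) * z i = 0) :
    ∃ c : Fin m → Loc 𝒜 x, (∀ i, z i = algebraMap A (Loc 𝒜 x) (F i) * c i) ∧ ∑ i, c i = 0 := by
  obtain ⟨⟨b, hb⟩, h⟩ :=
    IsLocalization.exist_integer_multiples_of_finite x.asHomogeneousIdeal.toIdeal.primeCompl z
  choose a ha using h
  replace ha (i : Fin m) : algebraMap A (Loc 𝒜 x) (a i) = algebraMap A (Loc 𝒜 x) b * z i :=
    (ha i).trans (Algebra.smul_def _ _)
  have hsum : ∑ i, a i * hat F i = 0 := by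
    apply algebraMap_loc_injective x
    rw [map_sum, map_zero, ← mul_zero (algebraMap A (Loc 𝒜 x) b), ← hz, Finset.mul_sum]
    exact Finset.sum_congr rfl fun i _ => by rw [map_mul, ha]; ring
  obtain ⟨c, hc, hc0⟩ := exists_eq_mul_of_sum_mul_hat_eq_zero hF hdvd hsum
  have hb0 : algebraMap A (Loc 𝒜 x) b ≠ 0 :=
    algebraMap_loc_ne_zero x fun h => hb (h ▸ zero_mem _)
  have hfrac (i : Fin m) : algebraMap A (Loc 𝒜 x) b * frac x (c i) b hb =
      algebraMap A (Loc 𝒜 x) (c i) := (eq_frac_iff hb).mp rfl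
  refine ⟨fun i => frac x (c i) b hb, fun i => mul_left_cancel₀ hb0 ?_, mul_left_cancel₀ hb0 ?_⟩
  · rw [mul_left_comm, hfrac, ← map_mul, ← hc, ha]
  · rw [Finset.mul_sum, Finset.sum_congr rfl fun i _ => hfrac i, ← map_sum, hc0, map_zero, mul_zero]

/-- The denominator and the numerator of a fraction `z` with `G z = c / s` for homogeneous `G`, `c`,
`s` can be chosen homogeneous. -/
theorem exists_homogeneous_frac {x : ProjectiveSpectrum 𝒜} {z : Loc 𝒜 x} {G c s : A} {e p q : ℕ}
    (hG : G ∈ 𝒜 e) (hc : c ∈ 𝒜 p) (hs : s ∈ 𝒜 q) {a : ℤ} (hd : (p : ℤ) = q + (a + e))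
    (hz : algebraMap A (Loc 𝒜 x) s * (algebraMap A (Loc 𝒜 x) G * z) = algebraMap A (Loc 𝒜 x) c) :
    ∃ (p' q' : ℕ) (c' s' : A), c' ∈ 𝒜 p' ∧ s' ∈ 𝒜 q' ∧ (p' : ℤ) = q' + a ∧
      s' ∉ x.asHomogeneousIdeal ∧ s' * c = c' * (s * G) := by
  classical
  obtain ⟨⟨c₁, s₁, hs₁⟩, h₁⟩ :=
    IsLocalization.surj x.asHomogeneousIdeal.toIdeal.primeCompl z
  have he : s₁ * c = c₁ * (s * G) := by
    apply algebraMap_loc_injective x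
    rw [map_mul, map_mul, ← hz, ← h₁, map_mul]
    ring
  obtain ⟨k, hk⟩ := exists_decompose_notMem hs₁
  -- Compare the components of degree `k + p`; on the right it is zero when `k + p < q + e`.
  have he' := congrArg (fun z => (DirectSum.decompose 𝒜 z (k + p) : A)) he
  simp only [DirectSum.coe_decompose_mul_of_right_mem 𝒜 _ hc,
    DirectSum.coe_decompose_mul_of_right_mem 𝒜 _ (SetLike.mul_mem_graded hs hG),
    Nat.le_add_left, if_true] at he'
  rw [Nat.add_sub_cancel] at he'
  split_ifs at he' with hle
  · exact ⟨k + p - (q + e), k, _, _, SetLike.coe_mem _, SetLike.coe_mem _, by omega, hk, he'⟩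
  · obtain ⟨p', q', s', hs', hx', hd'⟩ := exists_homogeneous_notMem x a
    have hc0 : c = 0 := (mul_eq_zero.mp he').resolve_left fun h => hk (h ▸ zero_mem _)
    exact ⟨p', q', 0, s', zero_mem _, hs', hd', hx', by rw [hc0, mul_zero, zero_mul]⟩

/-- If a section of `𝒪(a + e)` is divisible by the form `G` of degree `e` at each point, then the
quotients form a section of `𝒪(a)`. -/
theorem twistPredicate_of_mul {G : A} {e : ℕ} (hG : G ∈ 𝒜 e) (hG0 : G ≠ 0) {a b : ℤ}
    (hab : a + e = b) {U : Opens (ProjectiveSpectrum.top 𝒜)} {f t : ∀ x : U, Germs 𝒜 x.1}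
    (hf : (twistPredicate 𝒜 b).pred f)
    (ht : ∀ x, f x = algebraMap A (Germs 𝒜 x.1) G * t x) : (twistPredicate 𝒜 a).pred t := by
  intro x
  obtain ⟨V, hV, i, p, q, c, s, hc, hs, hd, hx, w⟩ := hf x
  have hfc (y : V) : algebraMap A (Germs 𝒜 y.1) s *
      (algebraMap A (Germs 𝒜 y.1) G * t (i y)) = algebraMap A (Germs 𝒜 y.1) c := by
    have h := (eq_frac_iff (hx y)).mp (w y)
    rw [← h]
    exact congrArg _ (ht (i y)).symm
  obtain ⟨p', q', c', s', hc', hs', hd', hx', he⟩ :=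
    exists_homogeneous_frac (a := a) hG hc hs (by omega) (hfc ⟨x.1, hV⟩)
  refine ⟨V ⊓ ProjectiveSpectrum.basicOpen 𝒜 s', ⟨hV, hx'⟩, Opens.infLELeft _ _ ≫ i, p', q', c', s',
    hc', hs', hd', fun y => y.2.2, fun y => (eq_frac_iff _).mpr ?_⟩
  have hy := hfc ⟨y.1, y.2.1⟩
  have hsG : algebraMap A (Germs 𝒜 y.1) (s * G) ≠ 0 := algebraMap_loc_ne_zero y.1 <|
    mul_ne_zero (fun h => hx ⟨y.1, y.2.1⟩ (h ▸ zero_mem _)) hG0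
  refine mul_right_cancel₀ hsG ?_
  change algebraMap A (Germs 𝒜 y.1) s' * t (i ⟨y.1, y.2.1⟩) * _ = algebraMap A (Germs 𝒜 y.1) c' * _
  rw [← map_mul _ c', ← he, map_mul, map_mul, ← hy]
  ring

end Fractions

/-! ### The short exact sequence -/

section ShortExact

variable {A σ : Type} [CommRing A] [SetLike σ A] [AddSubgroupClass σ A] {𝒜 : ℕ → σ}
  [GradedRing 𝒜] {m : ℕ} {d : Fin m → ℕ} {F : Fin m → A}

/-- The components of a section of `⨁ᵢ 𝒪(-d̂ᵢ)`, as families of germs. -/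
def componentGerms {ι : Type} [Fintype ι] {k : ι → ℤ} {U : (Proj 𝒜).Opens}
    (z : Γ(⨁ fun i => twist 𝒜 (k i), U)) (i : ι) : ∀ x : U, Germs 𝒜 x.1 :=
  germs ((biproduct.π (fun i => twist 𝒜 (k i)) i).app U z)

theorem componentGerms_ext {ι : Type} [Fintype ι] {k : ι → ℤ} {U : (Proj 𝒜).Opens}
    {y z : Γ(⨁ fun i => twist 𝒜 (k i), U)}
    (h : ∀ i x, componentGerms y i x = componentGerms z i x) : y = z :=
  biproduct_section_ext _ U fun i => germs_injective (funext (h i))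

theorem componentGerms_zero {ι : Type} [Fintype ι] {k : ι → ℤ} {U : (Proj 𝒜).Opens} (i : ι) :
    componentGerms (0 : Γ(⨁ fun i => twist 𝒜 (k i), U)) i = 0 := by
  rw [componentGerms, map_zero]
  rfl

theorem exists_componentGerms_eq {ι : Type} [Fintype ι] {k : ι → ℤ} {U : (Proj 𝒜).Opens}
    (f : ι → ∀ x : U, Germs 𝒜 x.1) (hf : ∀ i, (twistPredicate 𝒜 (k i)).pred (f i)) :
    ∃ z : Γ(⨁ fun i => twist 𝒜 (k i), U), ∀ i, componentGerms z i = f i := by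
  obtain ⟨z, hz⟩ := exists_biproduct_section (fun i => twist 𝒜 (k i)) U
    fun i => sectionOfGerms (isModulePredicate_twist (k i)) (f i) (hf i)
  exact ⟨z, fun i => congrArg germs (hz i)⟩

theorem germs_δ₁ (hF : ∀ i, F i ∈ 𝒜 (d i)) {U : (Proj 𝒜).Opens}
    (z : Γ(⨁ fun i => twist 𝒜 (-(hatDeg d i : ℤ)), U)) (x : U) :
    germs ((δ₁ hF).app U z) x =
      ∑ i, algebraMap A (Germs 𝒜 x.1) (hat F i) * componentGerms z i x := by
  have h : (δ₁ hF).app U z = _ := biproduct_desc_app _ _ U z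
  rw [h]
  refine (congrFun (germs_sum _ _) x).trans ?_
  rw [Finset.sum_apply]
  rfl

/-- A section of the ideal sheaf lifts locally along `δ₁`: if it is the fraction `c / s` on a
neighbourhood of `x` that contains the locus `h ≠ 0`, then `c h` vanishes on the whole stratum and is
therefore a combination of the `F̂ᵢ`. -/
theorem exists_δ₁_app_eq_map [IsDomain A] (hF : ∀ i, F i ∈ 𝒜 (d i))
    (hJ : saturatedIdeal 𝒜 (stratum 𝒜 F 2) = Ideal.span (Set.range (hat F)))
    (U : (Proj 𝒜).Opens) (f : Γ(idealSheaf (stratum 𝒜 F 2), U)) (x : Proj 𝒜) (hxU : x ∈ U) :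
    ∃ (V : (Proj 𝒜).Opens) (i : V ⟶ U) (z : Γ(⨁ fun i => twist 𝒜 (-(hatDeg d i : ℤ)), V)),
      x ∈ V ∧ (δ₁ hF).app V z = (idealSheaf (stratum 𝒜 F 2)).presheaf.map i.op f := by
  classical
  obtain ⟨hf, hvan⟩ := pred_germs f
  obtain ⟨V, hV, i, p, q, c, s, hc, hs, hd, hx, w⟩ := hf ⟨x, hxU⟩
  have hsc (y : V) : algebraMap A (Germs 𝒜 y.1) s * germs f ⟨y.1, leOfHom i y.2⟩ =
      algebraMap A (Germs 𝒜 y.1) c := (eq_frac_iff (hx y)).mp (w y)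
  obtain ⟨_, ⟨h, rfl⟩, hxh, hhV⟩ :=
    (ProjectiveSpectrum.isTopologicalBasis_basic_opens 𝒜).exists_subset_of_mem_open hV V.2
  obtain ⟨k, hk⟩ := exists_decompose_notMem (x := x) hxh
  have hch : c * h ∈ saturatedIdeal 𝒜 (stratum 𝒜 F 2) := by
    refine (forall_globalGerms_mem_iff _ _).mpr fun y hy => ?_
    by_cases hyh : h ∈ y.asHomogeneousIdeal
    · exact Ideal.mul_mem_left _ _ hyh
    · have hyV : y ∈ V := hhV hyh
      refine Ideal.mul_mem_right _ _ ((algebraMap_mem_maximalIdeal y c).mp ?_)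
      rw [← hsc ⟨y, hyV⟩]
      exact Ideal.mul_mem_left _ _ (hvan ⟨y, leOfHom i hyV⟩ hy)
  rw [hJ, Ideal.mem_span_range_iff_exists_fun] at hch
  obtain ⟨b, hb⟩ := hch
  obtain ⟨b', hb', hdeg⟩ := exists_homogeneous_coeff (hat_mem hF) (p := p + k) hb.symm
  rw [DirectSum.coe_decompose_mul_of_left_mem 𝒜 _ hc, if_pos (Nat.le_add_right p k),
    Nat.add_sub_cancel_left] at hb'
  -- Replace `h` by one of its homogeneous components that do not vanish at `x`.
  generalize hh' : (DirectSum.decompose 𝒜 h k : A) = h' at hk hb'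
  have hh'k : h' ∈ 𝒜 k := hh' ▸ SetLike.coe_mem _
  let W : Opens (ProjectiveSpectrum.top 𝒜) := V ⊓ ProjectiveSpectrum.basicOpen 𝒜 h'
  have hsh (y : W) : s * h' ∉ y.1.asHomogeneousIdeal := mul_notMem y.1 (hx ⟨y.1, y.2.1⟩) y.2.2
  obtain ⟨z, hz⟩ := exists_componentGerms_eq (k := fun i => -(hatDeg d i : ℤ)) (U := W)
    (fun j y => frac y.1 (b' j) (s * h') (hsh y)) (fun j => by
      obtain h0 | ⟨l, hl, hlp⟩ := hdeg j
      · have hzero : (fun y : W => frac y.1 (b' j) (s * h') (hsh y)) = fun _ => 0 :=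
          funext fun y => by rw [h0]; exact Localization.mk_zero _
        exact (congrArg (twistPredicate 𝒜 _).pred hzero).mpr ((isModulePredicate_twist _).zero W)
      · exact fun y => ⟨W, y.2, 𝟙 W, l, q + k, b' j, s * h', hl, SetLike.mul_mem_graded hs hh'k,
          by push_cast; omega, hsh, fun y => rfl⟩)
  refine ⟨W, Opens.infLELeft _ _ ≫ i, z, ⟨hV, hk⟩, germs_injective (funext fun y => ?_)⟩
  refine (germs_δ₁ hF (U := W) z y).trans ?_
  change _ = germs f ⟨y.1, leOfHom i y.2.1⟩
  have hne : algebraMap A (Germs 𝒜 y.1) (s * h') ≠ 0 :=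
    algebraMap_loc_ne_zero y.1 fun h0 => hsh y (h0 ▸ zero_mem _)
  have hy := hsc ⟨y.1, y.2.1⟩
  refine mul_left_cancel₀ hne ?_
  have hb'' := congrArg (algebraMap A (Germs 𝒜 y.1)) hb'
  rw [map_sum, map_mul, ← hy] at hb''
  rw [Finset.mul_sum, map_mul, mul_right_comm]
  refine Eq.trans (Finset.sum_congr rfl fun j _ => ?_) hb''.symm
  rw [congrFun (hz j) y, mul_left_comm, ← map_mul, (eq_frac_iff (hsh y)).mp rfl, map_mul, mul_comm]

variable [NeZero m]

theorem δ₀_π_of_ne_zero (hF : ∀ i, F i ∈ 𝒜 (d i)) (j : {j : Fin m // j ≠ 0}) :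
    δ₀ hF ≫ biproduct.π (fun i => twist 𝒜 (-(hatDeg d i : ℤ))) j.1 =
      biproduct.π _ j ≫ twistMul (hF j.1) (neg_sum_add d j.1) := by
  refine biproduct.hom_ext' _ _ fun l => ?_
  rw [δ₀, biproduct.ι_desc_assoc, Preadditive.sub_comp, Category.assoc, Category.assoc,
    biproduct.ι_π_ne _ j.2.symm, comp_zero, sub_zero]
  obtain rfl | hl := eq_or_ne l j
  · rw [biproduct.ι_π_self, Category.comp_id, biproduct.ι_π_self_assoc]
  · rw [biproduct.ι_π_ne _ fun h => hl (Subtype.ext h), comp_zero, biproduct.ι_π_ne_assoc _ hl,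
      zero_comp]

theorem δ₀_π_zero (hF : ∀ i, F i ∈ 𝒜 (d i)) :
    δ₀ hF ≫ biproduct.π (fun i => twist 𝒜 (-(hatDeg d i : ℤ))) 0 =
      -∑ j, biproduct.π _ j ≫ twistMul (hF 0) (neg_sum_add d 0) := by
  refine biproduct.hom_ext' _ _ fun l => ?_
  rw [δ₀, biproduct.ι_desc_assoc, Preadditive.sub_comp, Category.assoc, Category.assoc,
    biproduct.ι_π_ne _ l.2, comp_zero, zero_sub, biproduct.ι_π_self, Category.comp_id,
    Preadditive.comp_neg, Preadditive.comp_sum, Finset.sum_eq_single l, biproduct.ι_π_self_assoc]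
  · exact fun j _ hj => by rw [biproduct.ι_π_ne_assoc _ hj.symm, zero_comp]
  · simp

theorem componentGerms_δ₀_of_ne_zero (hF : ∀ i, F i ∈ 𝒜 (d i)) {U : (Proj 𝒜).Opens}
    (y : Γ(⨁ fun _ : {j : Fin m // j ≠ 0} => twist 𝒜 (-((∑ i, d i : ℕ) : ℤ)), U))
    (j : {j : Fin m // j ≠ 0}) (x : U) :
    componentGerms ((δ₀ hF).app U y) j.1 x =
      algebraMap A (Germs 𝒜 x.1) (F j.1) * componentGerms y j x :=
  congrFun (congrArg (fun φ => germs (Scheme.Modules.Hom.app φ U y)) (δ₀_π_of_ne_zero hF j)) x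

theorem componentGerms_δ₀_zero (hF : ∀ i, F i ∈ 𝒜 (d i)) {U : (Proj 𝒜).Opens}
    (y : Γ(⨁ fun _ : {j : Fin m // j ≠ 0} => twist 𝒜 (-((∑ i, d i : ℕ) : ℤ)), U)) (x : U) :
    componentGerms ((δ₀ hF).app U y) 0 x =
      -(algebraMap A (Germs 𝒜 x.1) (F 0) * ∑ j, componentGerms y j x) := by
  have h : (biproduct.π (fun i => twist 𝒜 (-(hatDeg d i : ℤ))) 0).app U ((δ₀ hF).app U y) =
      -∑ j, (biproduct.π (fun _ : {j : Fin m // j ≠ 0} => twist 𝒜 (-((∑ i, d i : ℕ) : ℤ))) j ≫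
        twistMul (hF 0) (neg_sum_add d 0)).app U y :=
    (congrArg (fun φ => Scheme.Modules.Hom.app φ U y) (δ₀_π_zero hF)).trans
      (congrArg Neg.neg (modules_sum_app _ _ U y))
  rw [componentGerms, h]
  refine congrArg Neg.neg ((congrFun (germs_sum _ _) x).trans ?_)
  rw [Finset.sum_apply, Finset.mul_sum]
  rfl

theorem δ₀_comp_δ₁ (hF : ∀ i, F i ∈ 𝒜 (d i)) : δ₀ hF ≫ δ₁ hF = 0 := by
  have hsq (i : Fin m) : twistMul (hF i) (neg_sum_add d i) ≫
      twistMulIdeal (stratum 𝒜 F 2) (hat_mem hF i) (hat_vanishes F i) =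
      twistMul (hF 0) (neg_sum_add d 0) ≫
        twistMulIdeal (stratum 𝒜 F 2) (hat_mem hF 0) (hat_vanishes F 0) := by
    ext U s
    refine germs_injective (funext fun x => ?_)
    change algebraMap A (Germs 𝒜 x.1) _ * (algebraMap A (Germs 𝒜 x.1) _ * germs s x) =
      algebraMap A (Germs 𝒜 x.1) _ * (algebraMap A (Germs 𝒜 x.1) _ * germs s x)
    rw [← mul_assoc, ← mul_assoc, ← map_mul, ← map_mul, mul_comm, mul_comm (hat F i),
      mul_comm (hat F 0), mul_hat, mul_hat, mul_comm]
  refine biproduct.hom_ext' _ _ fun j => ?_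
  rw [δ₀, δ₁, biproduct.ι_desc_assoc, Preadditive.sub_comp, Category.assoc, Category.assoc,
    biproduct.ι_desc, biproduct.ι_desc, hsq, sub_self, comp_zero]

variable [IsDomain A]

theorem δ₀_app_eq_zero (hF : ∀ i, F i ∈ 𝒜 (d i)) (hF0 : ∀ i, F i ≠ 0) (U : (Proj 𝒜).Opens)
    (y : Γ(⨁ fun _ : {j : Fin m // j ≠ 0} => twist 𝒜 (-((∑ i, d i : ℕ) : ℤ)), U))
    (hy : (δ₀ hF).app U y = 0) : y = 0 := by
  refine componentGerms_ext fun j x => ?_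
  have h := componentGerms_δ₀_of_ne_zero hF y j x
  rw [hy, componentGerms_zero] at h
  rw [componentGerms_zero]
  exact (mul_eq_zero.mp h.symm).resolve_left (algebraMap_loc_ne_zero x.1 (hF0 j.1))

theorem exists_δ₀_app_eq (hF : ∀ i, F i ∈ 𝒜 (d i)) (hprime : ∀ i, Prime (F i))
    (hdvd : ∀ i j, i ≠ j → ¬ F i ∣ F j) (U : (Proj 𝒜).Opens)
    (z : Γ(⨁ fun i => twist 𝒜 (-(hatDeg d i : ℤ)), U)) (hz : (δ₁ hF).app U z = 0) :
    ∃ y, (δ₀ hF).app U y = z := by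
  have hsum (x : U) :
      ∑ i, algebraMap A (Germs 𝒜 x.1) (hat F i) * componentGerms z i x = 0 := by
    rw [← germs_δ₁ hF z x, hz]
    rfl
  choose c hc hc0 using fun x : U =>
    exists_loc_eq_mul_of_sum_hat_mul_eq_zero hprime hdvd x.1 (hsum x)
  -- The component `c x 0` is determined by the others, as they add up to zero.
  obtain ⟨y, hy⟩ := exists_componentGerms_eq
    (fun (j : {j : Fin m // j ≠ 0}) (x : U) => (c x j.1 : Germs 𝒜 x.1)) fun j =>
      twistPredicate_of_mul (hF j.1) (hprime j.1).ne_zero (neg_sum_add d j.1)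
        (pred_germs ((biproduct.π (fun i => twist 𝒜 (-(hatDeg d i : ℤ))) j.1).app U z))
        fun x => hc x j.1
  refine ⟨y, componentGerms_ext fun i x => ?_⟩
  obtain rfl | hi := eq_or_ne i 0
  · have hx : ∑ j : {j : Fin m // j ≠ 0}, c x j.1 = -c x 0 := by
      refine eq_neg_of_add_eq_zero_right ?_
      rw [← hc0 x, ← Finset.add_sum_erase _ _ (Finset.mem_univ (0 : Fin m))]
      exact congrArg _ (Finset.sum_subtype _ (by simp) _).symm
    rw [componentGerms_δ₀_zero, hc x 0, Finset.sum_congr rfl fun j _ => congrFun (hy j) x]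
    exact (congrArg (fun w => -(_ * w)) hx).trans (by rw [mul_neg, neg_neg])
  · exact (componentGerms_δ₀_of_ne_zero hF y ⟨i, hi⟩ x).trans
      ((congrArg (_ * ·) (congrFun (hy ⟨i, hi⟩) x)).trans (hc x i).symm)

theorem shortExact_δ₀_δ₁ (hF : ∀ i, F i ∈ 𝒜 (d i)) (hprime : ∀ i, Prime (F i))
    (hdvd : ∀ i j, i ≠ j → ¬ F i ∣ F j)
    (hJ : saturatedIdeal 𝒜 (stratum 𝒜 F 2) = Ideal.span (Set.range (hat F))) :
    (ShortComplex.mk (δ₀ hF) (δ₁ hF) (δ₀_comp_δ₁ hF)).ShortExact := by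
  obtain ⟨hex, hmono⟩ := modules_exact_and_mono_of_sections
    (ShortComplex.mk (δ₀ hF) (δ₁ hF) (δ₀_comp_δ₁ hF))
    (δ₀_app_eq_zero hF fun i => (hprime i).ne_zero) (exists_δ₀_app_eq hF hprime hdvd)
  exact { exact := hex
          mono_f := hmono
          epi_g := modules_epi_of_locally_surjective _ (exists_δ₁_app_eq_map hF hJ) }

end ShortExact

end

end LogForms

theorem proposition8 (n m : ℕ) (hn : 2 ≤ n) [NeZero m] (d : Fin m → ℕ) (F : Fin m → LogForms.S n)
    (hF : ∀ i, F i ∈ LogForms.grading n (d i))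
    (hirr : ∀ i, Irreducible (F i))
    (hsmooth : ∀ i, LogForms.IsSmoothHypersurface (F i))
    (hnc : LogForms.IsNormalCrossings F) :
    LogForms.saturatedIdeal (LogForms.grading n) (LogForms.stratum (LogForms.grading n) F 2) =
        Ideal.span (Set.range (LogForms.hat F)) ∧
    LogForms.relations (LogForms.hat F) =
        Submodule.span (LogForms.S n)
          {v | ∃ i j : Fin m, i < j ∧ v = Pi.single j (F j) - Pi.single i (F i)} ∧
    LogForms.relations (LogForms.hat F) =
        Submodule.span (LogForms.S n)
          {v | ∃ j : Fin m, j ≠ 0 ∧ v = Pi.single j (F j) - Pi.single 0 (F 0)} ∧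
    ∃ w : LogForms.δ₀ hF ≫ LogForms.δ₁ hF = 0,
      (ShortComplex.mk (LogForms.δ₀ hF) (LogForms.δ₁ hF) w).ShortExact := by
  have hprime (i : Fin m) : Prime (F i) := (hirr i).prime
  have hdvd (i j : Fin m) (hij : i ≠ j) : ¬ F i ∣ F j := hnc.not_dvd hn hirr hij
  have hJ := hnc.saturatedIdeal_eq_span_hat hn hirr hF
  exact ⟨hJ, LogForms.relations_hat_eq_span_single_sub_single hprime hdvd,
    LogForms.relations_hat_eq_span_single_sub_single_zero hprime hdvd,
    LogForms.δ₀_comp_δ₁ hF, LogForms.shortExact_δ₀_δ₁ hF hprime hdvd hJ⟩
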